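/- Let $\eta(\tau)=e^{2\pi i\tau/24}\prod_{n\ge1}(1-e^{2\pi i n\tau})$ be the Dedekind eta function and let $$\mathfrak f(\tau)=\zeta_{48}^{-1}\,\frac{\eta\left(\frac{\tau+1}{2}\right)}{\eta(\tau)},\qquad \zeta_{48}=e^{2\pi i/48},$$ be the Weber function on the upper half-plane $\mathbb H$; it is a modular function of level $48$. Let $\ell$ be a prime not dividing $48$ (that is, $\ell\ge5$). The Weber modular polynomial $\Phi_\ell(x,y)$ is the irreducible polynomial in $\mathbb Z[x,y]$ (determined up to sign) such that $\Phi_\ell(\mathfrak f(\tau),\mathfrak f(\ell\tau))=0$ for all $\tau\in\mathbb H$. Such a polynomial exists, and the coefficient of the monomial $x^iy^j$ in $\Phi_\ell(x,y)$ is nonzero only if $$i+\ell j\equiv \ell+1 \pmod{24}.$$ -/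

import Mathlib

open Complex UpperHalfPlane Polynomial

/-- The Weber function `𝔣(τ) = ζ₄₈⁻¹ η((τ + 1) / 2) / η(τ)`, where `ζ₄₈ = exp(2πi / 48)`
(meaningful for `τ` in the upper half-plane). -/
noncomputable def weberF (τ : ℂ) : ℂ :=
  (cexp (2 * Real.pi * Complex.I / 48))⁻¹ * ModularForm.eta ((τ + 1) / 2) / ModularForm.eta τ

/-- `Φ ∈ ℤ[x, y]` is a modular polynomial of level `ℓ` with respect to the Weber function: it is
irreducible over `ℤ` and satisfies `Φ(𝔣(τ), 𝔣(ℓτ)) = 0` on the upper half-plane. This determines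
`Φ` up to sign. The inner variable of `ℤ[X][X]` is `x`, the outer variable is `y`, so the
coefficient of `x ^ i * y ^ j` is `(Φ.coeff j).coeff i`. -/
structure IsWeberModularPolynomial (ℓ : ℕ) (Φ : Polynomial (Polynomial ℤ)) : Prop where
  irreducible : Irreducible Φ
  relation : ∀ τ : ℍ, Polynomial.aevalAeval (weberF τ) (weberF (ℓ * τ)) Φ = 0

/-! Write f for `weberF`, t for the local parameter `cuspParam τ`, and ζ for `zeta24`. Since f is
1/t times a function of t^24, the shift τ ↦ τ + 2 multiplies f(τ) by ζ⁻¹ and f(ℓτ) by ζ^(-ℓ).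
Substituting τ + 2m in Φ(f(τ), f(ℓτ)) = 0 and averaging over m modulo 24 shows that the monomials
with i + ℓj ≡ ℓ + 1 form a relation by themselves, hence so do the remaining ones. The remaining
part is zero once its y-degree is at most ℓ. This holds because Φ has y-degree ℓ + 1 with constant
leading coefficient, and y^(ℓ+1) lies in the class ℓ² + ℓ ≡ ℓ + 1, as ℓ² ≡ 1 mod 24
(`IsWeberModularPolynomial.coeff_eq_zero`).

Two facts carry this. First, no nonzero relation has y-degree at most ℓ
(`eq_zero_of_relation_of_natDegree_le`): modular substitutions fixing f carry f(ℓτ) to the ℓ + 1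
functions f(ℓτ) and f((τ + 48k)/ℓ), which their leading terms at i∞ distinguish.

Second, there is an integral relation Q of y-degree ℓ + 1 with constant leading coefficient. The
coefficients of the monic polynomial in y with these conjugates as roots are modular for the theta
group with a multiplier and have poles only at i∞. As f is a Hauptmodul, they are polynomials in f
(`exists_polynomial_weberF`). The resulting complex relation becomes integral because all
t-expansions are integral (`exists_int_polynomial`).

Relations form a prime ideal, so some irreducible factor of Q is a modular polynomial. Conversely
every modular polynomial divides Q by pseudo-division, which fixes its degree and makes its leading
coefficient constant. -/

/-! ### Eta products and the basic transformations of the Weber function -/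

section

open Filter Topology

/-- Euler's product `∏ (1 - q ^ n)`, `n ≥ 1`. -/
noncomputable def eulerProd (q : ℂ) : ℂ := ∏' n : ℕ, (1 - q ^ (n + 1))

/-- The product `∏ (1 - q ^ n)` over odd `n`. -/
noncomputable def oddEulerProd (q : ℂ) : ℂ := ∏' n : ℕ, (1 - q ^ (2 * n + 1))

lemma multipliable_one_sub_pow_comp {q : ℂ} (hq : ‖q‖ < 1) {g : ℕ → ℕ}
    (hg : Function.Injective g) : Multipliable fun n ↦ 1 - q ^ (g n) := by
  simp_rw [sub_eq_add_neg]
  apply multipliable_one_add_of_summable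
  simpa [Function.comp_def] using
    (summable_geometric_of_lt_one (norm_nonneg _) hq).comp_injective hg

lemma norm_pow_lt_one {q : ℂ} (hq : ‖q‖ < 1) {n : ℕ} (hn : n ≠ 0) : ‖q ^ n‖ < 1 := by
  rw [norm_pow]; exact pow_lt_one₀ (norm_nonneg _) hq hn

lemma eulerProd_eq_odd_mul {q : ℂ} (hq : ‖q‖ < 1) :
    eulerProd q = oddEulerProd q * eulerProd (q ^ 2) := by
  rw [eulerProd, ← tprod_even_mul_odd (f := fun n ↦ 1 - q ^ (n + 1))
    (multipliable_one_sub_pow_comp hq (g := fun n ↦ 2 * n + 1) fun a b h ↦ by simpa using h)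
    (multipliable_one_sub_pow_comp hq (g := fun n ↦ 2 * n + 1 + 1) fun a b h ↦ by simpa using h)]
  congr 1
  refine tprod_congr fun n ↦ ?_
  rw [← pow_mul]; congr 2

lemma oddEulerProd_mul_neg {q : ℂ} (hq : ‖q‖ < 1) :
    oddEulerProd q * oddEulerProd (-q) = oddEulerProd (q ^ 2) := by
  have hi : Function.Injective fun n : ℕ ↦ 2 * n + 1 := fun a b h ↦ by simpa using h
  rw [oddEulerProd, oddEulerProd, ← (multipliable_one_sub_pow_comp hq hi).tprod_mul
    (multipliable_one_sub_pow_comp (by simpa using hq) hi)]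
  refine tprod_congr fun n ↦ ?_
  rw [← pow_mul, (odd_two_mul_add_one n).neg_pow]; ring

/-- Splitting off the odd-indexed factors reduces this to `oddEulerProd_mul_neg`. It serves to
eliminate the argument `(τ + 1) / 2` from `weberF`. -/
lemma eulerProd_neg_mul {q : ℂ} (hq : ‖q‖ < 1) :
    eulerProd (-q) * eulerProd q * eulerProd (q ^ 4) = eulerProd (q ^ 2) ^ 3 := by
  rw [eulerProd_eq_odd_mul hq, eulerProd_eq_odd_mul (q := -q) (by simpa using hq),
    neg_sq, show q ^ 4 = (q ^ 2) ^ 2 by ring]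
  have h1 := oddEulerProd_mul_neg hq
  have h2 := eulerProd_eq_odd_mul (norm_pow_lt_one hq two_ne_zero)
  linear_combination (eulerProd (q ^ 2)) ^ 2 * eulerProd ((q ^ 2) ^ 2) * h1 -
    eulerProd (q ^ 2) ^ 2 * h2

lemma eulerProd_ne_zero {q : ℂ} (hq : ‖q‖ < 1) : eulerProd q ≠ 0 := by
  rw [eulerProd]
  simp_rw [sub_eq_add_neg]
  refine tprod_one_add_ne_zero_of_summable (fun n ↦ ?_) ?_
  · rw [← sub_eq_add_neg, sub_ne_zero]
    intro h
    have := norm_pow_lt_one hq (n.succ_ne_zero)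
    rw [Nat.succ_eq_add_one, ← h] at this
    simp at this
  · simpa [Function.comp_def] using
      (summable_geometric_of_lt_one (norm_nonneg _) hq).comp_injective (add_left_injective 1)

lemma differentiableOn_eulerProd : DifferentiableOn ℂ eulerProd (Metric.ball 0 1) :=
  ModularForm.differentiableOn_tprod_one_sub_pow

lemma eulerProd_zero : eulerProd 0 = 1 := by simp [eulerProd]

lemma continuousAt_eulerProd_zero : ContinuousAt eulerProd 0 :=
  (differentiableOn_eulerProd.differentiableAt (Metric.ball_mem_nhds _ one_pos)).continuousAt

lemma eta_eq_eulerProd (z : ℂ) :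
    ModularForm.eta z = Function.Periodic.qParam 24 z * eulerProd (cexp (2 * Real.pi * Complex.I * z)) := by
  simp [ModularForm.eta, eulerProd, ModularForm.eta_q, Function.Periodic.qParam]

/-- The local parameter `exp (2πiτ / 48)` at the cusp `i∞`. -/
noncomputable def cuspParam (τ : ℂ) : ℂ := Function.Periodic.qParam 48 τ

lemma cuspParam_def (τ : ℂ) : cuspParam τ = cexp (2 * Real.pi * Complex.I * τ / 48) := by
  simp [cuspParam, Function.Periodic.qParam]

lemma cuspParam_ne_zero (τ : ℂ) : cuspParam τ ≠ 0 := by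
  rw [cuspParam_def]; exact exp_ne_zero _

lemma norm_cuspParam_lt_one {τ : ℂ} (hτ : 0 < τ.im) : ‖cuspParam τ‖ < 1 :=
  Function.Periodic.norm_qParam_lt_one (by norm_num) hτ

lemma cuspParam_natCast_mul (n : ℕ) (τ : ℂ) : cuspParam (n * τ) = cuspParam τ ^ n := by
  rw [cuspParam_def, cuspParam_def, ← Complex.exp_nat_mul]; congr 1; ring

lemma cuspParam_add (z w : ℂ) : cuspParam (z + w) = cuspParam z * cuspParam w := by
  simp only [cuspParam_def, ← Complex.exp_add]; congr 1; ring

lemma weberF_mul_cuspParam (τ : ℂ) :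
    weberF τ * cuspParam τ =
      eulerProd (-cuspParam τ ^ 24) / eulerProd (cuspParam τ ^ 48) := by
  have h1 : cexp (2 * Real.pi * Complex.I * ((τ + 1) / 2)) = -cuspParam τ ^ 24 := by
    rw [cuspParam_def, ← Complex.exp_nat_mul,
      show 2 * Real.pi * Complex.I * ((τ + 1) / 2) =
        (24 : ℕ) * (2 * Real.pi * Complex.I * τ / 48) + Real.pi * Complex.I by push_cast; ring,
      Complex.exp_add, exp_pi_mul_I]
    ring
  have h2 : cexp (2 * Real.pi * Complex.I * τ) = cuspParam τ ^ 48 := by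
    rw [cuspParam_def, ← Complex.exp_nat_mul]; congr 1; push_cast; ring
  have h3 : Function.Periodic.qParam 24 ((τ + 1) / 2) =
      cuspParam τ * cexp (2 * Real.pi * Complex.I / 48) := by
    rw [cuspParam_def, ← Complex.exp_add, Function.Periodic.qParam]; congr 1; push_cast; ring
  have h4 : Function.Periodic.qParam 24 τ = cuspParam τ ^ 2 := by
    rw [cuspParam_def, ← Complex.exp_nat_mul, Function.Periodic.qParam]
    congr 1; push_cast; ring
  rw [weberF, eta_eq_eulerProd, eta_eq_eulerProd, h1, h2, h3, h4]
  have := cuspParam_ne_zero τ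
  have := exp_ne_zero (2 * Real.pi * Complex.I / 48)
  field_simp

lemma weberF_eq (τ : ℂ) :
    weberF τ = eulerProd (-cuspParam τ ^ 24) / (cuspParam τ * eulerProd (cuspParam τ ^ 48)) := by
  rw [mul_comm, ← div_div, ← weberF_mul_cuspParam, mul_div_cancel_right₀ _ (cuspParam_ne_zero τ)]

lemma eta_ne_zero' {τ : ℂ} (hτ : 0 < τ.im) : ModularForm.eta τ ≠ 0 := ModularForm.eta_ne_zero hτ

lemma im_half_pos {τ : ℂ} (hτ : 0 < τ.im) : 0 < (τ / 2).im := by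
  simpa using hτ

lemma im_two_mul_pos {τ : ℂ} (hτ : 0 < τ.im) : 0 < (2 * τ).im := by
  simpa using hτ

/-- In this form the symmetry under τ ↦ -1/τ is visible: the substitution interchanges the roles of
τ/2 and 2τ. -/
lemma weberF_eq_eta_quotient {τ : ℂ} (hτ : 0 < τ.im) :
    weberF τ = ModularForm.eta τ ^ 2 / (ModularForm.eta (τ / 2) * ModularForm.eta (2 * τ)) := by
  have e1 : cexp (2 * Real.pi * Complex.I * τ) = cuspParam τ ^ 48 := by
    rw [cuspParam_def, ← Complex.exp_nat_mul]; congr 1; push_cast; ring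
  have e2 : cexp (2 * Real.pi * Complex.I * (τ / 2)) = cuspParam τ ^ 24 := by
    rw [cuspParam_def, ← Complex.exp_nat_mul]; congr 1; push_cast; ring
  have e3 : cexp (2 * Real.pi * Complex.I * (2 * τ)) = cuspParam τ ^ 96 := by
    rw [cuspParam_def, ← Complex.exp_nat_mul]; congr 1; push_cast; ring
  have e4 : Function.Periodic.qParam 24 τ = cuspParam τ ^ 2 := by
    rw [cuspParam_def, ← Complex.exp_nat_mul, Function.Periodic.qParam]
    congr 1; push_cast; ring
  have e5 : Function.Periodic.qParam 24 (τ / 2) = cuspParam τ := by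
    rw [cuspParam_def, Function.Periodic.qParam]
    congr 1; push_cast; ring
  have e6 : Function.Periodic.qParam 24 (2 * τ) = cuspParam τ ^ 4 := by
    rw [cuspParam_def, ← Complex.exp_nat_mul, Function.Periodic.qParam]
    congr 1; push_cast; ring
  rw [weberF_eq, eta_eq_eulerProd, eta_eq_eulerProd, eta_eq_eulerProd, e1, e2, e3, e4, e5, e6]
  have ht := norm_cuspParam_lt_one hτ
  have h0 := cuspParam_ne_zero τ
  set t := cuspParam τ
  have n1 := eulerProd_ne_zero (norm_pow_lt_one ht (n := 24) (by norm_num))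
  have n2 := eulerProd_ne_zero (norm_pow_lt_one ht (n := 48) (by norm_num))
  have n3 := eulerProd_ne_zero (norm_pow_lt_one ht (n := 96) (by norm_num))
  have key := eulerProd_neg_mul (norm_pow_lt_one ht (n := 24) (by norm_num))
  rw [← pow_mul, ← pow_mul] at key
  norm_num at key
  field_simp
  linear_combination key

lemma sqrt_sq' (z : ℂ) : Complex.sqrt z ^ 2 = z := by
  simp [Complex.sqrt]

lemma eta_neg_inv {τ : ℂ} (hτ : 0 < τ.im) :
    ModularForm.eta (-1 / τ) = (Complex.sqrt Complex.I)⁻¹ * (Complex.sqrt τ * ModularForm.eta τ) := by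
  simpa using ModularForm.eta_comp_eq_csqrt_I_inv hτ

/-- With z = τ/2 this makes the automorphy factors at τ/2 and 2τ multiply to τ, with no sign
ambiguity from the branch of the root. -/
lemma sqrt_four_mul {z : ℂ} (hz : z ≠ 0) : Complex.sqrt (4 * z) = 2 * Complex.sqrt z := by
  have h4 : (4 : ℂ) * z ≠ 0 := by simp [hz]
  rw [sqrt_eq_exp h4, sqrt_eq_exp hz]
  have := Complex.log_ofReal_mul (r := 4) (by norm_num) hz
  rw [Complex.ofReal_ofNat] at this
  rw [this, add_div, Complex.exp_add]
  congr 1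
  have h : Real.log 4 = 2 * Real.log 2 := by
    rw [show (4 : ℝ) = 2 ^ 2 by norm_num, Real.log_pow]; norm_num
  rw [h]
  push_cast
  rw [mul_div_cancel_left₀ _ two_ne_zero, ← Complex.ofReal_exp, Real.exp_log (by norm_num),
    Complex.ofReal_ofNat]

lemma ne_zero_of_im_pos {τ : ℂ} (hτ : 0 < τ.im) : τ ≠ 0 := by
  rintro rfl; simp at hτ

lemma im_neg_one_div_pos {τ : ℂ} (hτ : 0 < τ.im) : 0 < (-1 / τ).im := by
  have := Complex.normSq_pos.2 (ne_zero_of_im_pos hτ)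
  rw [neg_div, one_div, Complex.neg_im, Complex.inv_im]
  rw [neg_div, neg_neg]; positivity

lemma weberF_neg_inv {τ : ℂ} (hτ : 0 < τ.im) : weberF (-1 / τ) = weberF τ := by
  have h0 := ne_zero_of_im_pos hτ
  rw [weberF_eq_eta_quotient hτ, weberF_eq_eta_quotient (im_neg_one_div_pos hτ),
    show -1 / τ / 2 = -1 / (2 * τ) by field_simp, show 2 * (-1 / τ) = -1 / (τ / 2) by field_simp,
    eta_neg_inv hτ, eta_neg_inv (im_half_pos hτ), eta_neg_inv (im_two_mul_pos hτ),
    show 2 * τ = 4 * (τ / 2) by ring, sqrt_four_mul (div_ne_zero h0 two_ne_zero)]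
  have a1 := sqrt_sq' τ
  have a2 := sqrt_sq' (τ / 2)
  have a3 := sqrt_sq' Complex.I
  have n1 := eta_ne_zero' (im_half_pos hτ)
  have n2 := eta_ne_zero' (im_two_mul_pos hτ)
  rw [show 2 * τ = 4 * (τ / 2) by ring] at n2
  have n3 : Complex.sqrt Complex.I ≠ 0 := by
    intro h; rw [h] at a3; simp [eq_comm, Complex.I_ne_zero] at a3
  have n4 : Complex.sqrt (τ / 2) ≠ 0 := by
    intro h; rw [h] at a2; apply h0; simpa using a2.symm
  field_simp
  rw [a1, a2]; ring

lemma cexp_two_pi_mul_add_int (z : ℂ) (n : ℤ) :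
    cexp (2 * Real.pi * Complex.I * (z + n)) = cexp (2 * Real.pi * Complex.I * z) := by
  rw [mul_add, Complex.exp_add, mul_comm _ (n : ℂ), Complex.exp_int_mul_two_pi_mul_I, mul_one]

/-- The primitive root of unity `exp (2πi / 24)`. -/
noncomputable def zeta24 : ℂ := cexp (2 * Real.pi * Complex.I / 24)

lemma zeta24_isPrimitiveRoot : IsPrimitiveRoot zeta24 24 :=
  Complex.isPrimitiveRoot_exp 24 (by norm_num)

lemma zeta24_ne_zero : zeta24 ≠ 0 := exp_ne_zero _

lemma cuspParam_two_mul (n : ℤ) : cuspParam (2 * n) = zeta24 ^ n := by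
  rw [cuspParam_def, zeta24, ← Complex.exp_int_mul]; congr 1; ring

/-- The shift multiplies t by a 24th root of unity, which the Euler products in t^24 and t^48 do not
see; only the factor 1/t changes. -/
lemma weberF_add_two_mul (τ : ℂ) (n : ℤ) : weberF (τ + 2 * n) = zeta24 ^ (-n) * weberF τ := by
  rw [weberF_eq, weberF_eq, cuspParam_add, cuspParam_two_mul]
  have h24 : (zeta24 ^ n) ^ 24 = 1 := by
    rw [← zpow_natCast, zpow_comm, zpow_natCast, zeta24_isPrimitiveRoot.pow_eq_one, one_zpow]
  have h48 : (zeta24 ^ n) ^ 48 = 1 := by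
    rw [show 48 = 24 * 2 by rfl, pow_mul, h24, one_pow]
  have hn : zeta24 ^ n ≠ 0 := zpow_ne_zero _ zeta24_ne_zero
  rw [mul_pow, mul_pow, h24, h48, mul_one, mul_one, zpow_neg]
  rw [mul_comm (cuspParam τ), mul_assoc, ← div_div, div_eq_mul_inv _ (zeta24 ^ n)]
  ring

lemma weberF_add_forty_eight_mul (τ : ℂ) (n : ℤ) : weberF (τ + 48 * n) = weberF τ := by
  have := weberF_add_two_mul τ (24 * n)
  push_cast at this
  rw [show τ + 48 * n = τ + 2 * (24 * n) by ring, this, neg_mul_eq_mul_neg, zpow_mul]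
  have h : zeta24 ^ (24 : ℤ) = 1 := mod_cast zeta24_isPrimitiveRoot.pow_eq_one
  rw [h, one_zpow, one_mul]

lemma differentiableAt_weberF {τ : ℂ} (hτ : 0 < τ.im) : DifferentiableAt ℂ weberF τ := by
  unfold weberF
  refine .div (.mul (by fun_prop) ?_)
    (ModularForm.differentiableAt_eta_of_mem_upperHalfPlaneSet hτ) (eta_ne_zero' hτ)
  refine DifferentiableAt.comp τ (g := ModularForm.eta) (f := fun z ↦ (z + 1) / 2)
    (ModularForm.differentiableAt_eta_of_mem_upperHalfPlaneSet ?_) (by fun_prop)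
  change 0 < ((τ + 1) / 2).im
  simpa using hτ

lemma tendsto_cuspParam : Tendsto (fun τ : ℍ ↦ cuspParam τ) atImInfty (𝓝 0) :=
  qParam_tendsto_atImInfty (by norm_num)

lemma tendsto_eulerProd_quotient :
    Tendsto (fun t : ℂ ↦ eulerProd (-t ^ 24) / eulerProd (t ^ 48)) (𝓝 0) (𝓝 1) := by
  have h1 : Tendsto (fun t : ℂ ↦ eulerProd (-t ^ 24)) (𝓝 0) (𝓝 1) := by
    have := continuousAt_eulerProd_zero.tendsto
    rw [eulerProd_zero] at this
    exact this.comp (Continuous.tendsto' (by fun_prop) _ _ (by simp))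
  have h2 : Tendsto (fun t : ℂ ↦ eulerProd (t ^ 48)) (𝓝 0) (𝓝 1) := by
    have := continuousAt_eulerProd_zero.tendsto
    rw [eulerProd_zero] at this
    exact this.comp (Continuous.tendsto' (by fun_prop) _ _ (by simp))
  simpa [Pi.div_def] using h1.div h2 one_ne_zero

lemma tendsto_weberF_mul_cuspParam :
    Tendsto (fun τ : ℍ ↦ weberF τ * cuspParam τ) atImInfty (𝓝 1) := by
  simp_rw [weberF_mul_cuspParam]
  exact tendsto_eulerProd_quotient.comp tendsto_cuspParam

lemma eta_add_one (z : ℂ) : ModularForm.eta (z + 1) = zeta24 * ModularForm.eta z := by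
  have h : cexp (2 * Real.pi * Complex.I * (z + 1)) = cexp (2 * Real.pi * Complex.I * z) := by
    simpa using cexp_two_pi_mul_add_int z 1
  rw [eta_eq_eulerProd, eta_eq_eulerProd, h, zeta24, ← mul_assoc, Function.Periodic.qParam,
    Function.Periodic.qParam, ← Complex.exp_add]
  congr 2; push_cast; ring

/-- This gives the behaviour at the cusp 1. Squaring turns the quotient of the square roots of 2τ
and τ into 2, so no branch has to be determined. -/
lemma weberF_one_sub_inv_sq {τ : ℂ} (hτ : 0 < τ.im) :
    weberF (1 + -1 / τ) ^ 2 = (cexp (2 * Real.pi * Complex.I / 48))⁻¹ ^ 2 * 2 *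
      (ModularForm.eta (2 * τ) / ModularForm.eta τ) ^ 2 := by
  have h0 := ne_zero_of_im_pos hτ
  rw [weberF, show (1 + -1 / τ + 1) / 2 = -1 / (2 * τ) + 1 by field_simp; ring,
    show 1 + -1 / τ = -1 / τ + 1 by ring, eta_add_one, eta_add_one, eta_neg_inv hτ,
    eta_neg_inv (im_two_mul_pos hτ)]
  have a1 := sqrt_sq' τ
  have a2 := sqrt_sq' (2 * τ)
  have a3 := sqrt_sq' Complex.I
  have n1 := eta_ne_zero' hτ
  have n3 : Complex.sqrt Complex.I ≠ 0 := by
    intro h; rw [h] at a3; simp [eq_comm, Complex.I_ne_zero] at a3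
  have n4 : Complex.sqrt τ ≠ 0 := by
    intro h; rw [h] at a1; apply h0; simpa using a1.symm
  have n5 := zeta24_ne_zero
  have n6 := exp_ne_zero (2 * Real.pi * Complex.I / 48)
  field_simp
  rw [a1, a2]; ring

lemma isBoundedAtImInfty_weberF_one_sub_inv :
    IsBoundedAtImInfty (fun τ : ℍ ↦ weberF (1 + -1 / (τ : ℂ))) := by
  have h : Tendsto (fun t : ℂ ↦ t ^ 2 * (eulerProd (t ^ 96) / eulerProd (t ^ 48))) (𝓝 0) (𝓝 0) := by
    have h1 (n : ℕ) (hn : n ≠ 0) : Tendsto (fun t : ℂ ↦ eulerProd (t ^ n)) (𝓝 0) (𝓝 1) := by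
      have := continuousAt_eulerProd_zero.tendsto
      rw [eulerProd_zero] at this
      exact this.comp (Continuous.tendsto' (by fun_prop) _ _ (by simp [hn]))
    have h2 : Tendsto (fun t : ℂ ↦ t ^ 2) (𝓝 0) (𝓝 0) :=
      Continuous.tendsto' (by fun_prop) _ _ (by simp)
    simpa using h2.mul ((h1 96 (by norm_num)).div (h1 48 (by norm_num)) one_ne_zero)
  -- The leading terms are t^4 and t^2, so the quotient is t^2 times a function tending to 1.
  have h' : Tendsto (fun τ : ℍ ↦ ModularForm.eta (2 * τ) / ModularForm.eta τ) atImInfty (𝓝 0) := by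
    refine (h.comp tendsto_cuspParam).congr fun τ ↦ ?_
    have e1 : cexp (2 * Real.pi * Complex.I * τ) = cuspParam τ ^ 48 := by
      rw [cuspParam_def, ← Complex.exp_nat_mul]; congr 1; push_cast; ring
    have e3 : cexp (2 * Real.pi * Complex.I * (2 * τ)) = cuspParam τ ^ 96 := by
      rw [cuspParam_def, ← Complex.exp_nat_mul]; congr 1; push_cast; ring
    have e4 : Function.Periodic.qParam 24 τ = cuspParam τ ^ 2 := by
      rw [cuspParam_def, ← Complex.exp_nat_mul, Function.Periodic.qParam]
      congr 1; push_cast; ring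
    have e6 : Function.Periodic.qParam 24 (2 * τ) = cuspParam τ ^ 4 := by
      rw [cuspParam_def, ← Complex.exp_nat_mul, Function.Periodic.qParam]
      congr 1; push_cast; ring
    rw [Function.comp_apply, eta_eq_eulerProd, eta_eq_eulerProd, e1, e3, e4, e6]
    have := cuspParam_ne_zero τ
    have n2 := eulerProd_ne_zero (norm_pow_lt_one (norm_cuspParam_lt_one τ.im_pos) (n := 48)
      (by norm_num))
    field_simp
  have h'' : Tendsto (fun τ : ℍ ↦ weberF (1 + -1 / (τ : ℂ)) ^ 2) atImInfty (𝓝 0) := by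
    have := (h'.pow 2).const_mul ((cexp (2 * Real.pi * Complex.I / 48))⁻¹ ^ 2 * 2)
    rw [zero_pow two_ne_zero, mul_zero] at this
    exact this.congr fun τ ↦ (weberF_one_sub_inv_sq τ.im_pos).symm
  rw [isBoundedAtImInfty_iff]
  have h3 := h''.norm.eventually_lt_const (u := 1) (by simp)
  rw [Filter.Eventually, atImInfty_mem] at h3
  obtain ⟨A, hA⟩ := h3
  refine ⟨1, A, fun z hz ↦ ?_⟩
  have := hA z hz
  simp only [norm_pow, Set.mem_ofPred_eq] at this
  exact (abs_le_one_iff_mul_self_le_one.2 (by rw [← sq]; exact this.le)).trans' (le_abs_self _)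

end

/-! ### The theta group and the multiplier of the Weber function -/

section

open Filter Topology
open scoped MatrixGroups

lemma coe_S_smul (τ : ℍ) : ((ModularGroup.S • τ : ℍ) : ℂ) = -1 / τ := by
  rw [modular_S_smul]; simp [neg_div]

lemma coe_T_smul (τ : ℍ) : ((ModularGroup.T • τ : ℍ) : ℂ) = τ + 1 := by
  rw [modular_T_smul, coe_vadd]; simp [add_comm]

lemma coe_T_zpow_smul (n : ℤ) (τ : ℍ) : ((ModularGroup.T ^ n • τ : ℍ) : ℂ) = τ + n := by
  rw [modular_T_zpow_smul, coe_vadd]; simp [add_comm]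

lemma coe_TS_smul (τ : ℍ) :
    (((ModularGroup.T * ModularGroup.S) • τ : ℍ) : ℂ) = 1 + -1 / τ := by
  rw [mul_smul, coe_T_smul, coe_S_smul, add_comm]

/-- An element of the theta group (given by the parity conditions) together with the explicit
value of the multiplier of `weberF` at it. -/
structure IsThetaMultiplier (γ : SL(2, ℤ)) (e : ℤ) : Prop where
  odd_left : Odd (γ 0 0 + γ 1 0)
  odd_right : Odd (γ 0 1 + γ 1 1)
  weberF_smul : ∀ τ : ℍ, weberF (γ • τ : ℍ) = zeta24 ^ e * weberF τ
  even_case : Even (γ 1 0) → 16 ∣ 2 * e - γ 1 1 * (γ 1 0 - γ 0 1)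
  odd_case : Odd (γ 1 0) → 16 ∣ 2 * e + γ 1 0 * (γ 0 0 + γ 1 1)
  mod_three : 3 ∣ e - ((γ 0 0 + γ 1 1) * γ 1 0 - γ 0 1 * γ 1 1 * (γ 1 0 ^ 2 - 1))

lemma SL2_det (γ : SL(2, ℤ)) : γ 0 0 * γ 1 1 - γ 0 1 * γ 1 0 = 1 := by
  have := γ.det_coe; rwa [Matrix.det_fin_two] at this

lemma SL2_mul_S (γ : SL(2, ℤ)) : (γ * ModularGroup.S) 0 0 = γ 0 1 ∧
    (γ * ModularGroup.S) 0 1 = -γ 0 0 ∧ (γ * ModularGroup.S) 1 0 = γ 1 1 ∧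
    (γ * ModularGroup.S) 1 1 = -γ 1 0 := by
  simp [ModularGroup.coe_S, Matrix.mul_apply, Fin.sum_univ_two]

lemma SL2_mul_T_zpow (γ : SL(2, ℤ)) (n : ℤ) : (γ * ModularGroup.T ^ n) 0 0 = γ 0 0 ∧
    (γ * ModularGroup.T ^ n) 0 1 = γ 0 1 + n * γ 0 0 ∧ (γ * ModularGroup.T ^ n) 1 0 = γ 1 0 ∧
    (γ * ModularGroup.T ^ n) 1 1 = γ 1 1 + n * γ 1 0 := by
  simp [ModularGroup.coe_T_zpow, Matrix.mul_apply, Fin.sum_univ_two]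
  constructor <;> ring

lemma isThetaMultiplier_one : IsThetaMultiplier 1 0 where
  odd_left := by simp
  odd_right := by simp
  weberF_smul := by simp
  even_case := by simp
  odd_case := by simp
  mod_three := by simp

/-- The exponent formula modulo 3 is compatible with right multiplication by `S`; being a
congruence, it is settled by a finite check in `ZMod 3`. -/
lemma three_dvd_mul_S (a b c d : ℤ) (h : a * d - b * c = 1) :
    (3 : ℤ) ∣ ((a + d) * c - b * d * (c ^ 2 - 1)) - ((b + -c) * d - -a * -c * (d ^ 2 - 1)) := by
  have key : ∀ a b c d : ZMod 3, a * d - b * c = 1 →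
    ((a + d) * c - b * d * (c ^ 2 - 1)) - ((b + -c) * d - -a * -c * (d ^ 2 - 1)) = 0 := by
    decide
  have := key a b c d (by exact_mod_cast congrArg (Int.cast : ℤ → ZMod 3) h)
  refine (ZMod.intCast_zmod_eq_zero_iff_dvd _ 3).1 ?_
  push_cast
  exact this

lemma three_dvd_mul_T_zpow (a b c d s : ℤ) (h : a * d - b * c = 1) :
    (3 : ℤ) ∣ ((a + d) * c - b * d * (c ^ 2 - 1)) - s -
      ((a + (d + 2 * s * c)) * c - (b + 2 * s * a) * (d + 2 * s * c) * (c ^ 2 - 1)) := by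
  have key : ∀ a b c d s : ZMod 3, a * d - b * c = 1 →
    ((a + d) * c - b * d * (c ^ 2 - 1)) - s -
      ((a + (d + 2 * s * c)) * c - (b + 2 * s * a) * (d + 2 * s * c) * (c ^ 2 - 1)) = 0 := by
    decide
  have := key a b c d s (by exact_mod_cast congrArg (Int.cast : ℤ → ZMod 3) h)
  refine (ZMod.intCast_zmod_eq_zero_iff_dvd _ 3).1 ?_
  push_cast
  exact this

/-- The exponent is unchanged because `weberF` is invariant under `S`. In the theta group exactly
one entry of the bottom row is even, so `even_case` and `odd_case` trade places. -/
lemma IsThetaMultiplier.mul_S {γ : SL(2, ℤ)} {e : ℤ} (h : IsThetaMultiplier γ e) :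
    IsThetaMultiplier (γ * ModularGroup.S) e := by
  obtain ⟨h1, h2, h3, h4⟩ := SL2_mul_S γ
  have hdet := SL2_det γ
  have ol := h.odd_left
  have or := h.odd_right
  have ec := h.even_case
  have oc := h.odd_case
  have m3 := h.mod_three
  have m3' := three_dvd_mul_S _ _ _ _ hdet
  refine ⟨?_, ?_, fun τ ↦ ?_, ?_, ?_, ?_⟩
  · rwa [h1, h3]
  · rw [h2, h4, ← neg_add]; exact ol.neg
  · rw [mul_smul, h.weberF_smul, coe_S_smul, weberF_neg_inv τ.im_pos]
  · rw [h2, h3, h4]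
    intro hd
    have hc : Odd (γ 1 0) := by
      by_contra hc
      rw [Int.not_odd_iff_even] at hc
      have : Even (1 : ℤ) := hdet ▸ (hd.mul_left _).sub (hc.mul_left _)
      simp at this
    convert oc hc using 1
    ring
  · rw [h1, h3, h4]
    intro hd
    have hc : Even (γ 1 0) := by
      by_contra hc
      rw [Int.not_even_iff_odd] at hc
      have hb : Even (γ 0 1) := by
        rw [← Int.not_odd_iff_even]; intro hb; exact Int.not_even_iff_odd.2 or (hb.add_odd hd)
      have ha : Even (γ 0 0) := by
        rw [← Int.not_odd_iff_even]; intro ha; exact Int.not_even_iff_odd.2 ol (ha.add_odd hc)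
      have : Even (1 : ℤ) := hdet ▸ (ha.mul_right _).sub (hb.mul_right _)
      simp at this
    convert ec hc using 1
    ring
  · rw [h1, h2, h3, h4]
    exact (dvd_add m3 m3').trans (dvd_of_eq (by ring))

lemma IsThetaMultiplier.mul_T_zpow {γ : SL(2, ℤ)} {e : ℤ} (h : IsThetaMultiplier γ e) {s : ℤ}
    (hs : s ^ 2 = 1) : IsThetaMultiplier (γ * ModularGroup.T ^ (2 * s)) (e - s) := by
  obtain ⟨h1, h2, h3, h4⟩ := SL2_mul_T_zpow γ (2 * s)
  have hdet := SL2_det γ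
  have ol := h.odd_left
  have or := h.odd_right
  have m3 := h.mod_three
  have m3' := three_dvd_mul_T_zpow _ _ _ _ s hdet
  refine ⟨?_, ?_, fun τ ↦ ?_, ?_, ?_, ?_⟩
  · rwa [h1, h3]
  · rw [h2, h4]
    convert or.add_even (even_two_mul (s * (γ 0 0 + γ 1 0))) using 1
    ring
  · have := weberF_add_two_mul τ s
    rw [mul_smul, h.weberF_smul, coe_T_zpow_smul]
    push_cast
    rw [this, sub_eq_add_neg, zpow_add₀ zeta24_ne_zero, mul_assoc]
  · rw [h2, h3, h4]
    intro hc
    have ec := h.even_case hc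
    have ha : Odd (γ 0 0) := by
      by_contra ha
      rw [Int.not_odd_iff_even] at ha
      exact Int.not_even_iff_odd.2 ol (ha.add hc)
    have hd : Odd (γ 1 1) := by
      by_contra hd
      rw [Int.not_odd_iff_even] at hd
      have : Even (1 : ℤ) := hdet ▸ (hd.mul_left _).sub (hc.mul_left _)
      simp at this
    have hb : Even (γ 0 1) := by
      by_contra hb
      rw [Int.not_even_iff_odd] at hb
      exact Int.not_even_iff_odd.2 or (hb.add_odd hd)
    obtain ⟨C, hC⟩ := even_iff_exists_two_mul.1 hc
    obtain ⟨B, hB⟩ := even_iff_exists_two_mul.1 hb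
    have hs' : Odd s := by
      rw [← Int.not_even_iff_odd]; intro h'
      have : Even (1 : ℤ) := hs ▸ h'.pow_of_ne_zero two_ne_zero
      simp at this
    have hev : Even (C * (γ 0 0 - s * C)) := by
      rcases Int.even_or_odd C with h' | h'
      · exact h'.mul_right _
      · exact (ha.sub_odd (hs'.mul h')).mul_left _
    obtain ⟨k, hk⟩ := even_iff_exists_two_mul.1 hev
    obtain ⟨m, hm⟩ := ec
    refine ⟨m + s * B * C + k, ?_⟩
    rw [hC, hB] at hm hdet ⊢
    linear_combination hm + 8 * hk + 2 * s * hdet + 8 * C * γ 0 0 * hs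
  · rw [h1, h3, h4]
    intro hc
    obtain ⟨m, hm⟩ := h.odd_case hc
    obtain ⟨k, hk⟩ := hc
    -- The expression changes by 2s(c² - 1), and c² ≡ 1 mod 8 for odd c.
    obtain ⟨j, hj⟩ := even_iff_exists_two_mul.1 (Int.even_mul_succ_self k)
    refine ⟨m + s * j, ?_⟩
    rw [hk] at hm ⊢
    linear_combination hm + 8 * s * hj
  · rw [h1, h2, h3, h4]
    exact (dvd_add m3 m3').trans (dvd_of_eq (by ring))

/-- Keeps the coset of `T * S` stable under right multiplication by `T`: the prefix S³T⁻² lies in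
the theta group and is absorbed into the coset's left factor. -/
lemma ModularGroup.T_mul_S_mul_T : (T * S * T : SL(2, ℤ)) = S * S * S * T ^ (2 * (-1) : ℤ) * T * S := by
  ext i j
  fin_cases i <;> fin_cases j <;>
    simp [coe_T, coe_S, Matrix.mul_apply, Fin.sum_univ_two, sq]

lemma ModularGroup.T_mul_S_mul_T_inv :
    (T * S * T⁻¹ : SL(2, ℤ)) = T ^ (2 * 1 : ℤ) * S * T * S := by
  rw [← zpow_neg_one]
  ext i j
  fin_cases i <;> fin_cases j <;>
    simp [coe_T, coe_S, Matrix.mul_apply, Fin.sum_univ_two, sq]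

lemma ModularGroup.S_mul_S_mul_S : (S * S * S : SL(2, ℤ)) = S⁻¹ := by
  rw [eq_inv_iff_mul_eq_one]
  ext i j
  fin_cases i <;> fin_cases j <;>
    simp [coe_S, Matrix.mul_apply, Fin.sum_univ_two]

lemma ModularGroup.T_mul_S_mul_S : (T * S * S : SL(2, ℤ)) = S * S * T := by
  ext i j
  fin_cases i <;> fin_cases j <;>
    simp [coe_S, coe_T, Matrix.mul_apply, Fin.sum_univ_two]

/-- `1`, `T`, `T * S` represent the cosets of the theta group in `SL(2, ℤ)`. -/
lemma exists_isThetaMultiplier (γ : SL(2, ℤ)) : ∃ δ e, IsThetaMultiplier δ e ∧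
    (γ = δ ∨ γ = δ * ModularGroup.T ∨ γ = δ * ModularGroup.T * ModularGroup.S) := by
  let P (γ : SL(2, ℤ)) : Prop := ∃ δ e, IsThetaMultiplier δ e ∧
    (γ = δ ∨ γ = δ * ModularGroup.T ∨ γ = δ * ModularGroup.T * ModularGroup.S)
  have hS : ∀ γ, P γ → P (γ * ModularGroup.S) := by
    rintro γ ⟨δ, e, h, rfl | rfl | rfl⟩
    · exact ⟨_, _, h.mul_S, Or.inl rfl⟩
    · exact ⟨_, _, h, Or.inr (Or.inr rfl)⟩
    · refine ⟨_, _, h.mul_S.mul_S, Or.inr (Or.inl ?_)⟩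
      simp only [mul_assoc]
      rw [← mul_assoc ModularGroup.T, ModularGroup.T_mul_S_mul_S, mul_assoc]
  have hT : ∀ γ, P γ → P (γ * ModularGroup.T) := by
    rintro γ ⟨δ, e, h, rfl | rfl | rfl⟩
    · exact ⟨_, _, h, Or.inr (Or.inl rfl)⟩
    · refine ⟨_, _, h.mul_T_zpow (s := 1) (by norm_num), Or.inl ?_⟩
      rw [mul_one, mul_assoc, zpow_two]
    · refine ⟨_, _, h.mul_S.mul_S.mul_S.mul_T_zpow (s := -1) (by norm_num), Or.inr (Or.inr ?_)⟩
      have := congrArg (δ * ·) ModularGroup.T_mul_S_mul_T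
      simpa only [mul_assoc] using this
  have hT' : ∀ γ, P γ → P (γ * ModularGroup.T⁻¹) := by
    rintro γ ⟨δ, e, h, rfl | rfl | rfl⟩
    · refine ⟨_, _, h.mul_T_zpow (s := -1) (by norm_num), Or.inr (Or.inl ?_)⟩
      rw [mul_assoc, ← zpow_add_one, ← zpow_neg_one]; norm_num
    · exact ⟨_, _, h, Or.inl (mul_inv_cancel_right _ _)⟩
    · refine ⟨_, _, (h.mul_T_zpow (s := 1) (by norm_num)).mul_S, Or.inr (Or.inr ?_)⟩
      have := congrArg (δ * ·) ModularGroup.T_mul_S_mul_T_inv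
      simpa only [mul_assoc] using this
  have hmem : γ ∈ Subgroup.closure {ModularGroup.S, ModularGroup.T} := by
    rw [SpecialLinearGroup.SL2Z_generators]; trivial
  refine Subgroup.closure_induction_right (p := fun γ _ ↦ P γ) ?_ ?_ ?_ hmem
  · exact ⟨1, 0, isThetaMultiplier_one, Or.inl rfl⟩
  · rintro x _ y (rfl | rfl) hx
    exacts [hS _ hx, hT _ hx]
  · rintro x _ y (rfl | rfl) hx
    · rw [← ModularGroup.S_mul_S_mul_S, ← mul_assoc, ← mul_assoc]
      exact hS _ (hS _ (hS _ hx))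
    · exact hT' _ hx

lemma SL2_mul_T (γ : SL(2, ℤ)) : (γ * ModularGroup.T) 0 0 = γ 0 0 ∧
    (γ * ModularGroup.T) 0 1 = γ 0 1 + γ 0 0 ∧ (γ * ModularGroup.T) 1 0 = γ 1 0 ∧
    (γ * ModularGroup.T) 1 1 = γ 1 1 + γ 1 0 := by
  simpa using SL2_mul_T_zpow γ 1

lemma exists_isThetaMultiplier_of_odd {γ : SL(2, ℤ)} (h1 : Odd (γ 0 0 + γ 1 0))
    (h2 : Odd (γ 0 1 + γ 1 1)) : ∃ e, IsThetaMultiplier γ e := by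
  obtain ⟨δ, e, h, rfl | rfl | rfl⟩ := exists_isThetaMultiplier γ
  · exact ⟨e, h⟩
  · obtain ⟨-, e2, -, e4⟩ := SL2_mul_T δ
    rw [e2, e4] at h2
    have := h.odd_left.add_odd h.odd_right
    exact absurd h2 (Int.not_odd_iff_even.2 (by rwa [show δ 0 1 + δ 0 0 + (δ 1 1 + δ 1 0) = δ 0 0 + δ 1 0 + (δ 0 1 + δ 1 1) by ring]))
  · obtain ⟨-, e2, -, e4⟩ := SL2_mul_T δ
    obtain ⟨e5, -, e7, -⟩ := SL2_mul_S (δ * ModularGroup.T)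
    rw [e5, e7, e2, e4] at h1
    have := h.odd_left.add_odd h.odd_right
    exact absurd h1 (Int.not_odd_iff_even.2 (by rwa [show δ 0 1 + δ 0 0 + (δ 1 1 + δ 1 0) = δ 0 0 + δ 1 0 + (δ 0 1 + δ 1 1) by ring]))

/-- The parity condition excludes the first two cosets. Geometrically, γ sends i∞ to a fraction with
odd numerator and denominator, a cusp equivalent to 1. -/
lemma exists_weberF_smul_of_even {γ : SL(2, ℤ)} (h1 : Even (γ 0 0 + γ 1 0)) :
    ∃ e : ℤ, ∀ τ : ℍ, weberF (γ • τ : ℍ) =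
      zeta24 ^ e * weberF ((ModularGroup.T * ModularGroup.S) • τ : ℍ) := by
  obtain ⟨δ, e, h, rfl | rfl | rfl⟩ := exists_isThetaMultiplier γ
  · exact absurd h.odd_left (Int.not_odd_iff_even.2 h1)
  · obtain ⟨e1, -, e3, -⟩ := SL2_mul_T δ
    rw [e1, e3] at h1
    exact absurd h.odd_left (Int.not_odd_iff_even.2 h1)
  · refine ⟨e, fun τ ↦ ?_⟩
    rw [mul_assoc, mul_smul, h.weberF_smul]

/-- Here c is odd, so `odd_case` gives 8 ∣ e and `mod_three` gives 3 ∣ e; the multiplier is trivial.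
Such matrices arise when `S` permutes the functions f((τ + 48k)/ℓ). -/
lemma weberF_smul_of_dvd {γ : SL(2, ℤ)} (ha : 48 ∣ γ 0 0) (hd : 48 ∣ γ 1 1) (τ : ℍ) :
    weberF (γ • τ : ℍ) = weberF τ := by
  have hdet := SL2_det γ
  obtain ⟨k, hk⟩ := ha
  obtain ⟨m, hm⟩ := hd
  have hbc : Odd (γ 0 1 * γ 1 0) :=
    ⟨24 * k * γ 1 1 - 1, by rw [hk] at hdet; linear_combination -hdet⟩
  obtain ⟨hb, hc⟩ := Int.odd_mul.1 hbc
  have hle : Even (γ 0 0) := ⟨24 * k, by rw [hk]; ring⟩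
  have hre : Even (γ 1 1) := ⟨24 * m, by rw [hm]; ring⟩
  obtain ⟨e, h⟩ := exists_isThetaMultiplier_of_odd (hle.add_odd hc) (hb.add_even hre)
  have h16 := h.odd_case hc
  have h3 := h.mod_three
  rw [hk, hm] at h16 h3
  have h8 : (8 : ℤ) ∣ e := by
    obtain ⟨j, hj⟩ := h16
    refine ⟨j - 3 * γ 1 0 * (k + m), ?_⟩
    have : 2 * e = 2 * (8 * (j - 3 * γ 1 0 * (k + m))) := by linear_combination hj
    omega
  have h3' : (3 : ℤ) ∣ e := by
    obtain ⟨j, hj⟩ := h3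
    exact ⟨j + 16 * (k + m) * γ 1 0 - γ 0 1 * (16 * m) * (γ 1 0 ^ 2 - 1),
      by linear_combination hj⟩
  have h24 : (24 : ℤ) ∣ e := by omega
  obtain ⟨j, rfl⟩ := h24
  have hz : zeta24 ^ (24 : ℤ) = 1 := mod_cast zeta24_isPrimitiveRoot.pow_eq_one
  rw [h.weberF_smul, zpow_mul, hz, one_zpow, one_mul]

end

/-! ### The Weber function as a Hauptmodul -/

section

open Filter Topology
open scoped MatrixGroups Manifold ModularForm
open ModularGroup (S T)

lemma mdifferentiable_comp_SL2_smul {G : ℍ → ℂ} (hG : MDifferentiable 𝓘(ℂ) 𝓘(ℂ) G) (γ : SL(2, ℤ)) :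
    MDifferentiable 𝓘(ℂ) 𝓘(ℂ) fun τ ↦ G (γ • τ) :=
  hG.comp (mdifferentiable_smul (g := (γ : GL (Fin 2) ℝ)) (by simp))

/-- A holomorphic function invariant under `SL(2, ℤ)` that tends to zero at `i∞` vanishes. -/
lemma eq_zero_of_isZeroAtImInfty_of_invariant {N : ℍ → ℂ} (hN : MDifferentiable 𝓘(ℂ) 𝓘(ℂ) N)
    (hS : ∀ τ, N (S • τ) = N τ) (hT : ∀ τ, N (T • τ) = N τ) (h0 : IsZeroAtImInfty N) : N = 0 := by
  have hS' : N ∣[(0 : ℤ)] S = N := by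
    ext τ; rw [ModularForm.SL_slash_apply, hS]; simp
  have hT' : N ∣[(0 : ℤ)] T = N := by
    ext τ; rw [ModularForm.SL_slash_apply, hT]; simp
  have hinv := SlashInvariantForm.slash_action_generators_SL2Z hS' hT'
  let F : ModularForm 𝒮ℒ 0 :=
    { toFun := N
      slash_action_eq' := by
        rintro A ⟨A, rfl⟩
        exact hinv A
      holo' := hN
      bdd_at_cusps' := by
        intro c hc
        rw [OnePoint.isBoundedAt_iff_forall_SL2Z hc]
        intro γ _
        rw [hinv]
        exact h0.isBoundedAtImInfty }
  obtain ⟨c, hc⟩ := ModularFormClass.levelOne_weight_zero_const F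
  have hc' : N = Function.const _ c := hc
  have : Tendsto N atImInfty (𝓝 c) := by rw [hc']; exact tendsto_const_nhds
  rw [hc', tendsto_nhds_unique this h0]
  rfl

lemma tendsto_T_smul_atImInfty : Tendsto (fun τ : ℍ ↦ T • τ) atImInfty atImInfty :=
  tendsto_smul_atImInfty (g := (T : GL (Fin 2) ℝ)) (by simp [ModularGroup.coe_T])

lemma T_mul_S_smul_T (τ : ℍ) : (T * S) • T • τ = S • T ^ (-2 : ℤ) • (T * S) • τ := by
  have h : (T * S * T : SL(2, ℤ)) = S * S * (S * T ^ (-2 : ℤ) * (T * S)) := by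
    rw [show (-2 : ℤ) = 2 * (-1) by norm_num]
    simpa only [mul_assoc] using ModularGroup.T_mul_S_mul_T
  have hSS (σ : ℍ) : S • S • σ = σ := by
    ext; rw [coe_S_smul, coe_S_smul]; field_simp [ne_zero σ]
  calc (T * S) • T • τ = (T * S * T : SL(2, ℤ)) • τ := by rw [mul_smul (T * S)]
    _ = _ := by rw [h]; simp only [mul_smul]; rw [hSS]

/-- A function for the theta group, with a multiplier, that vanishes at `i∞` and is bounded at the
other cusp is zero. -/
lemma eq_zero_of_theta_invariant {G : ℍ → ℂ} (hG : MDifferentiable 𝓘(ℂ) 𝓘(ℂ) G)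
    (hS : ∀ τ, G (S • τ) = G τ) {c : ℂ} (hc : c ^ 24 = 1)
    (hT : ∀ τ, G (T ^ (2 : ℤ) • τ) = c * G τ) (h0 : IsZeroAtImInfty G)
    (hb : IsBoundedAtImInfty fun τ ↦ G ((T * S) • τ)) : G = 0 := by
  -- The 24th power removes the multiplier `c`.
  let H : ℍ → ℂ := fun τ ↦ G τ ^ 24
  have hH : MDifferentiable 𝓘(ℂ) 𝓘(ℂ) H := hG.pow 24
  have hHS (τ) : H (S • τ) = H τ := congrArg (· ^ 24) (hS τ)
  have hHT (τ) : H (T ^ (2 : ℤ) • τ) = H τ := by simp only [H, hT, mul_pow, hc, one_mul]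
  have hHT' (τ) : H (T ^ (-2 : ℤ) • τ) = H τ := by
    rw [← hHT, smul_smul, ← zpow_add]; simp
  have hHTT (τ) : H (T • T • τ) = H τ := by rw [← hHT τ, zpow_two, mul_smul]
  have hT1 : MDifferentiable 𝓘(ℂ) 𝓘(ℂ) fun τ ↦ H (T • τ) := mdifferentiable_comp_SL2_smul hH T
  have hT2 : MDifferentiable 𝓘(ℂ) 𝓘(ℂ) fun τ ↦ H ((T * S) • τ) := mdifferentiable_comp_SL2_smul hH _
  -- The norm from the theta group to SL(2, ℤ). Two factors vanish at i∞ and the third is bounded,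
  -- so the level one lemma applies; afterwards one of the holomorphic factors must be zero.
  have hzero : (H * fun τ ↦ H (T • τ)) * (fun τ ↦ H ((T * S) • τ)) = 0 := by
    apply eq_zero_of_isZeroAtImInfty_of_invariant ((hH.mul hT1).mul hT2)
    · intro τ
      have hSS (σ : ℍ) : S • S • σ = σ := by
        ext; rw [coe_S_smul, coe_S_smul]; field_simp [ne_zero σ]
      simp only [Pi.mul_apply, hHS, mul_smul, hSS]
      ring
    · intro τ
      simp only [Pi.mul_apply, T_mul_S_smul_T, hHS, hHT', hHTT]
      ring
    · have z1 : IsZeroAtImInfty H := by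
        have := h0.pow 24
        rwa [zero_pow (by norm_num)] at this
      have z2 : IsZeroAtImInfty fun τ ↦ H (T • τ) := z1.comp tendsto_T_smul_atImInfty
      have z3 : IsBoundedAtImInfty fun τ ↦ H ((T * S) • τ) := by
        exact (Asymptotics.IsBigO.pow hb 24).congr_right fun τ ↦ by simp
      have z4 : IsZeroAtImInfty (H * fun τ ↦ H (T • τ)) :=
        z1.mul_boundedAtFilter z2.isBoundedAtImInfty
      exact z4.mul_boundedAtFilter z3
  have hfin : H = 0 := by
    rcases (mul_eq_zero_iff (hH.mul hT1) hT2).1 hzero with h | h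
    · rcases (mul_eq_zero_iff hH hT1).1 h with h | h
      · exact h
      · ext τ
        have := congrFun h (T⁻¹ • τ)
        rwa [smul_inv_smul] at this
    · ext τ
      have := congrFun h ((T * S)⁻¹ • τ)
      rwa [smul_inv_smul] at this
  ext τ
  have := congrFun hfin τ
  simpa [H] using this

/-- Functions on the upper half-plane that are holomorphic, meromorphic at `i∞` and bounded at the
cusp `1`. -/
structure IsRegularAwayFromInfty (G : ℍ → ℂ) : Prop where
  mdifferentiable : MDifferentiable 𝓘(ℂ) 𝓘(ℂ) G
  growth : ∃ n : ℕ, IsBoundedAtImInfty fun τ ↦ G τ * cuspParam τ ^ n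
  bounded : IsBoundedAtImInfty fun τ ↦ G ((T * S) • τ)

lemma isBoundedAtImInfty_cuspParam_pow (n : ℕ) :
    IsBoundedAtImInfty fun τ : ℍ ↦ cuspParam τ ^ n :=
  (tendsto_cuspParam.pow n).isBigO_one ℝ

lemma isBoundedAtImInfty_growth_mono {G : ℍ → ℂ} {n m : ℕ} (h : n ≤ m)
    (hn : IsBoundedAtImInfty fun τ ↦ G τ * cuspParam τ ^ n) :
    IsBoundedAtImInfty fun τ ↦ G τ * cuspParam τ ^ m := by
  obtain ⟨k, rfl⟩ := Nat.exists_eq_add_of_le h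
  have : IsBoundedAtImInfty ((fun τ ↦ G τ * cuspParam τ ^ n) * fun τ : ℍ ↦ cuspParam τ ^ k) :=
    BoundedAtFilter.mul hn (isBoundedAtImInfty_cuspParam_pow k)
  exact this.congr_left fun τ ↦ by simp [pow_add, mul_assoc]

namespace IsRegularAwayFromInfty

lemma const (c : ℂ) : IsRegularAwayFromInfty fun _ ↦ c where
  mdifferentiable := mdifferentiable_const
  growth := ⟨0, (const_boundedAtFilter atImInfty c).congr_left fun τ ↦ by simp⟩
  bounded := const_boundedAtFilter atImInfty c

lemma add {G H : ℍ → ℂ} (hG : IsRegularAwayFromInfty G) (hH : IsRegularAwayFromInfty H) :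
    IsRegularAwayFromInfty (G + H) where
  mdifferentiable := hG.mdifferentiable.add hH.mdifferentiable
  growth := by
    obtain ⟨n, hn⟩ := hG.growth
    obtain ⟨m, hm⟩ := hH.growth
    refine ⟨max n m, ?_⟩
    have := BoundedAtFilter.add (isBoundedAtImInfty_growth_mono (le_max_left n m) hn)
      (isBoundedAtImInfty_growth_mono (le_max_right n m) hm)
    exact this.congr_left fun τ ↦ by simp [add_mul]
  bounded := BoundedAtFilter.add hG.bounded hH.bounded

lemma mul {G H : ℍ → ℂ} (hG : IsRegularAwayFromInfty G) (hH : IsRegularAwayFromInfty H) :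
    IsRegularAwayFromInfty (G * H) where
  mdifferentiable := hG.mdifferentiable.mul hH.mdifferentiable
  growth := by
    obtain ⟨n, hn⟩ := hG.growth
    obtain ⟨m, hm⟩ := hH.growth
    refine ⟨n + m, ?_⟩
    have := BoundedAtFilter.mul hn hm
    exact this.congr_left fun τ ↦ by simp only [Pi.mul_apply, pow_add]; ring
  bounded := BoundedAtFilter.mul hG.bounded hH.bounded

end IsRegularAwayFromInfty

/-- The ring of functions that are regular away from `i∞`. -/
def regularSubring : Subring (ℍ → ℂ) where
  carrier := {G | IsRegularAwayFromInfty G}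
  mul_mem' := .mul
  one_mem' := .const 1
  add_mem' := .add
  zero_mem' := .const 0
  neg_mem' {G} hG := by
    have := (IsRegularAwayFromInfty.const (-1)).mul hG
    rwa [show (fun _ : ℍ ↦ (-1 : ℂ)) * G = -G by ext; simp] at this

lemma periodic_comp_ofComplex {H : ℍ → ℂ} (hH : ∀ τ, H (T ^ (48 : ℤ) • τ) = H τ) :
    Function.Periodic (H ∘ ofComplex) (48 : ℝ) := by
  intro w
  by_cases! hw : 0 < w.im
  · have : 0 < (w + (48 : ℝ)).im := by simpa using hw
    simp only [Function.comp_apply, ofComplex_apply_of_im_pos this, ofComplex_apply_of_im_pos hw]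
    rw [← hH ⟨w, hw⟩]
    congr 1
    ext
    rw [coe_T_zpow_smul]; simp
  -- Off the upper half-plane `ofComplex` takes a constant default value, so periodicity is
  -- automatic.
  · have : (w + (48 : ℝ)).im ≤ 0 := by simpa using hw
    simp only [Function.comp_apply, ofComplex_apply_of_im_nonpos this, ofComplex_apply_of_im_nonpos hw]

lemma norm_cuspParam (τ : ℍ) : ‖cuspParam τ‖ = Real.exp (-2 * Real.pi * τ.im / 48) :=
  Function.Periodic.norm_qParam 48 τ

lemma tendsto_valueAtInfty {H : ℍ → ℂ} (hd : MDifferentiable 𝓘(ℂ) 𝓘(ℂ) H)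
    (hH : ∀ τ, H (T ^ (48 : ℤ) • τ) = H τ) (hb : IsBoundedAtImInfty H) :
    Tendsto H atImInfty (𝓝 (valueAtInfty H)) := by
  have := exp_decay_sub_atImInfty (by norm_num) (periodic_comp_ofComplex hH) hd hb
  have h0 : Tendsto (fun τ : ℍ ↦ Real.exp (-2 * Real.pi * τ.im / 48)) atImInfty (𝓝 0) := by
    simpa [norm_cuspParam] using tendsto_cuspParam.norm
  simpa using (this.trans_tendsto h0).add_const (valueAtInfty H)

/-- A 48-periodic holomorphic function vanishing at i∞ is divisible by t. This lowers the pole order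
in `exists_polynomial_weberF`. -/
lemma isBoundedAtImInfty_div_cuspParam {H : ℍ → ℂ} (hd : MDifferentiable 𝓘(ℂ) 𝓘(ℂ) H)
    (hH : ∀ τ, H (T ^ (48 : ℤ) • τ) = H τ) (h0 : IsZeroAtImInfty H) :
    IsBoundedAtImInfty fun τ ↦ H τ / cuspParam τ := by
  have := h0.exp_decay_atImInfty (by norm_num) (periodic_comp_ofComplex hH) hd
    h0.isBoundedAtImInfty
  have h1 : H =O[atImInfty] fun τ : ℍ ↦ cuspParam τ := by
    refine this.trans (Asymptotics.isBigO_of_le _ fun τ ↦ ?_)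
    rw [norm_cuspParam, Real.norm_of_nonneg (Real.exp_nonneg _)]
  have h2 := h1.mul (Asymptotics.isBigO_refl (fun τ : ℍ ↦ (cuspParam τ)⁻¹) atImInfty)
  refine (h2.congr_left fun τ ↦ (div_eq_mul_inv _ _).symm).trans
    (Asymptotics.isBigO_of_le _ fun τ ↦ ?_)
  rw [mul_inv_cancel₀ (cuspParam_ne_zero _)]
  simp

lemma mdifferentiable_cuspParam : MDifferentiable 𝓘(ℂ) 𝓘(ℂ) fun τ : ℍ ↦ cuspParam τ := by
  rw [mdifferentiable_iff]
  refine DifferentiableOn.congr (f := cuspParam) ?_ fun z hz ↦ ?_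
  · simp only [funext cuspParam_def]; fun_prop
  · simp [ofComplex_apply_of_im_pos hz]

lemma mdifferentiable_weberF_comp {g : ℂ → ℂ} (hg : Differentiable ℂ g)
    (him : ∀ z : ℂ, 0 < z.im → 0 < (g z).im) :
    MDifferentiable 𝓘(ℂ) 𝓘(ℂ) fun τ : ℍ ↦ weberF (g τ) := by
  rw [mdifferentiable_iff]
  refine DifferentiableOn.congr (f := weberF ∘ g) ?_ fun z hz ↦ ?_
  · intro z hz
    exact ((differentiableAt_weberF (him z hz)).comp z (hg z)).differentiableWithinAt
  · simp [ofComplex_apply_of_im_pos hz]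

lemma isRegularAwayFromInfty_weberF : IsRegularAwayFromInfty fun τ : ℍ ↦ weberF τ where
  mdifferentiable := mdifferentiable_weberF_comp (g := id) differentiable_id fun _ ↦ id
  growth := ⟨1, (tendsto_weberF_mul_cuspParam.isBigO_one ℝ).congr_left fun τ ↦ by simp⟩
  bounded := by
    simp only [coe_TS_smul]
    exact isBoundedAtImInfty_weberF_one_sub_inv

lemma T_zpow_forty_eight_invariant {G : ℍ → ℂ} {c : ℂ} (hc : c ^ 24 = 1)
    (hT : ∀ τ, G (T ^ (2 : ℤ) • τ) = c * G τ) (τ : ℍ) : G (T ^ (48 : ℤ) • τ) = G τ := by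
  have h (n : ℕ) : G ((T ^ (2 : ℤ)) ^ n • τ) = c ^ n * G τ := by
    induction n with
    | zero => simp
    | succ n ih => rw [pow_succ', mul_smul, hT, ih, pow_succ']; ring
  have := h 24
  rwa [hc, one_mul, ← zpow_natCast, ← zpow_mul] at this

lemma cuspParam_T_sq_smul (τ : ℍ) : cuspParam (T ^ (2 : ℤ) • τ : ℍ) = zeta24 * cuspParam τ := by
  rw [coe_T_zpow_smul, cuspParam_add, mul_comm]
  congr 1
  simpa using cuspParam_two_mul 1

lemma weberF_T_sq_smul (τ : ℍ) : weberF (T ^ (2 : ℤ) • τ : ℍ) = zeta24⁻¹ * weberF τ := by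
  rw [coe_T_zpow_smul]
  simpa using weberF_add_two_mul τ 1

lemma tendsto_T_zpow_smul_atImInfty (n : ℤ) :
    Tendsto (fun τ : ℍ ↦ T ^ n • τ) atImInfty atImInfty := by
  rw [atImInfty, tendsto_comap_iff]
  refine tendsto_comap.congr fun τ ↦ ?_
  rw [Function.comp_apply, ← coe_im, ← coe_im, coe_T_zpow_smul]
  simp

/-- The Weber function is a Hauptmodul: functions for the theta group with a multiplier, with poles
only at `i∞`, are polynomials in `weberF`. -/
theorem exists_polynomial_weberF {G : ℍ → ℂ} (hG : IsRegularAwayFromInfty G)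
    (hS : ∀ τ, G (S • τ) = G τ) {c : ℂ} (hc : c ^ 24 = 1)
    (hT : ∀ τ, G (T ^ (2 : ℤ) • τ) = c * G τ) :
    ∃ P : ℂ[X], ∀ τ : ℍ, G τ = P.eval (weberF τ) := by
  obtain ⟨n, hn⟩ := hG.growth
  -- the leading term at `i∞`
  have step : ∀ (G : ℍ → ℂ) (n : ℕ), IsRegularAwayFromInfty G →
      (∀ τ, G (T ^ (2 : ℤ) • τ) = c * G τ) →
      IsBoundedAtImInfty (fun τ ↦ G τ * cuspParam τ ^ n) →
      ∃ L : ℂ, IsZeroAtImInfty (fun τ ↦ (G τ - L * weberF τ ^ n) * cuspParam τ ^ n) ∧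
        ∀ τ : ℍ, (G (T ^ (2 : ℤ) • τ) - L * weberF (T ^ (2 : ℤ) • τ : ℍ) ^ n) =
          c * (G τ - L * weberF τ ^ n) := by
    intro G n hG hT hn
    let H : ℍ → ℂ := fun τ ↦ G τ * cuspParam τ ^ n
    have hHT (τ) : H (T ^ (2 : ℤ) • τ) = (c * zeta24 ^ n) * H τ := by
      simp only [H, hT, cuspParam_T_sq_smul, mul_pow]; ring
    have hc' : (c * zeta24 ^ n) ^ 24 = 1 := by
      rw [mul_pow, hc, ← pow_mul, mul_comm n, pow_mul, zeta24_isPrimitiveRoot.pow_eq_one]; simp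
    have hlim : Tendsto H atImInfty (𝓝 (valueAtInfty H)) := tendsto_valueAtInfty (hG.mdifferentiable.mul (mdifferentiable_cuspParam.pow n))
      (T_zpow_forty_eight_invariant hc' hHT) hn
    set L := valueAtInfty H
    -- Translation by 2 fixes i∞. Thus L ≠ 0 forces c ζ^n = 1, and L f^n transforms with the same
    -- multiplier as `G`.
    have hL : L = (c * zeta24 ^ n) * L := by
      have h1 := hlim.comp (tendsto_T_zpow_smul_atImInfty 2)
      refine tendsto_nhds_unique h1 ((hlim.const_mul (c * zeta24 ^ n)).congr fun τ ↦ ?_)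
      exact (hHT τ).symm
    refine ⟨L, ?_, fun τ ↦ ?_⟩
    · have := hlim.sub ((tendsto_weberF_mul_cuspParam.pow n).const_mul L)
      rw [one_pow, mul_one, sub_self] at this
      refine this.congr fun τ ↦ ?_
      simp only [mul_pow]; ring
    · rw [hT, weberF_T_sq_smul, mul_pow, inv_pow]
      have hz := pow_ne_zero n zeta24_ne_zero
      have : L * (zeta24 ^ n)⁻¹ = c * L := by
        rw [mul_inv_eq_iff_eq_mul₀ hz]; linear_combination hL
      linear_combination -(weberF τ) ^ n * this
  have hsub (G : ℍ → ℂ) (hG : IsRegularAwayFromInfty G) (L : ℂ) (n : ℕ) :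
      IsRegularAwayFromInfty fun τ : ℍ ↦ G τ - L * weberF τ ^ n := by
    have h1 : (fun τ : ℍ ↦ weberF τ) ∈ regularSubring := isRegularAwayFromInfty_weberF
    have h2 : (fun _ : ℍ ↦ L) ∈ regularSubring := .const L
    exact regularSubring.sub_mem hG (regularSubring.mul_mem h2 (regularSubring.pow_mem h1 n))
  have hS' (G : ℍ → ℂ) (hS : ∀ τ, G (S • τ) = G τ) (L : ℂ) (n : ℕ) (τ : ℍ) :
      G (S • τ) - L * weberF (S • τ : ℍ) ^ n = G τ - L * weberF τ ^ n := by
    rw [hS, coe_S_smul, weberF_neg_inv τ.im_pos]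
  induction n generalizing G with
  | zero =>
    obtain ⟨L, h1, h2⟩ := step G 0 hG hT hn
    have hz := eq_zero_of_theta_invariant (hsub G hG L 0).mdifferentiable (hS' G hS L 0) hc h2
      (by simpa using h1) (hsub G hG L 0).bounded
    refine ⟨C L, fun τ ↦ ?_⟩
    have := congrFun hz τ
    simp only [pow_zero, mul_one, Pi.zero_apply, sub_eq_zero] at this
    rw [this, eval_C]
  | succ n ih =>
    -- Subtracting the leading term leaves a function whose product with t^(n+1) tends to 0 and
    -- hence is divisible by t: the pole order is now at most `n`.
    obtain ⟨L, h1, h2⟩ := step G (n + 1) hG hT hn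
    have hinv := T_zpow_forty_eight_invariant (c := c * zeta24 ^ (n + 1))
      (G := fun τ ↦ (G τ - L * weberF τ ^ (n + 1)) * cuspParam τ ^ (n + 1))
      (by rw [mul_pow, hc, ← pow_mul, mul_comm (n + 1), pow_mul,
        zeta24_isPrimitiveRoot.pow_eq_one]; simp)
      (fun τ ↦ by rw [h2, cuspParam_T_sq_smul, mul_pow]; ring)
    have hb := isBoundedAtImInfty_div_cuspParam
      ((hsub G hG L (n + 1)).mdifferentiable.mul (mdifferentiable_cuspParam.pow (n + 1))) hinv h1
    obtain ⟨P, hP⟩ := ih (hsub G hG L (n + 1)) (hS' G hS L (n + 1)) h2 (by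
      refine hb.congr_left fun τ ↦ ?_
      have := cuspParam_ne_zero τ
      simp only [Pi.mul_apply, Pi.pow_apply]
      field_simp
      ring)
    refine ⟨P + C L * X ^ (n + 1), fun τ ↦ ?_⟩
    have := hP τ
    simp only [eval_add, eval_mul, eval_C, eval_pow, eval_X]
    linear_combination this

end

/-! ### Integral expansions and descent of relations from ℂ to ℤ -/

section

open Filter Topology
open scoped Nat

/-- Holomorphic functions on the unit disc whose Taylor coefficients at the origin are integers. -/
structure HasIntTaylor (h : ℂ → ℂ) : Prop where
  differentiableOn : DifferentiableOn ℂ h (Metric.ball 0 1)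
  exists_int : ∀ n : ℕ, ∃ m : ℤ, iteratedDeriv n h 0 = n ! * m

namespace HasIntTaylor

lemma contDiffAt {h : ℂ → ℂ} (hh : HasIntTaylor h) (n : WithTop ℕ∞) : ContDiffAt ℂ n h 0 :=
  (hh.differentiableOn.analyticAt (Metric.ball_mem_nhds _ one_pos)).contDiffAt

lemma intCast (m : ℤ) : HasIntTaylor fun _ ↦ (m : ℂ) where
  differentiableOn := differentiableOn_const _
  exists_int n := by
    rw [iteratedDeriv_const]
    split_ifs with h
    · exact ⟨m, by simp [h]⟩
    · exact ⟨0, by simp⟩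

lemma id : HasIntTaylor fun t ↦ t where
  differentiableOn := differentiableOn_id
  exists_int n := by
    change ∃ m : ℤ, iteratedDeriv n _root_.id 0 = _
    rw [iteratedDeriv_id]
    split_ifs with h h'
    · exact ⟨0, by simp⟩
    · exact ⟨1, by simp [h']⟩
    · exact ⟨0, by simp⟩

lemma add {g h : ℂ → ℂ} (hg : HasIntTaylor g) (hh : HasIntTaylor h) : HasIntTaylor (g + h) where
  differentiableOn := hg.differentiableOn.add hh.differentiableOn
  exists_int n := by
    obtain ⟨a, ha⟩ := hg.exists_int n
    obtain ⟨b, hb⟩ := hh.exists_int n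
    exact ⟨a + b, by rw [iteratedDeriv_add (hg.contDiffAt _) (hh.contDiffAt _), ha, hb]; push_cast; ring⟩

lemma mul {g h : ℂ → ℂ} (hg : HasIntTaylor g) (hh : HasIntTaylor h) : HasIntTaylor (g * h) where
  differentiableOn := hg.differentiableOn.mul hh.differentiableOn
  exists_int n := by
    choose a ha using hg.exists_int
    choose b hb using hh.exists_int
    refine ⟨∑ i ∈ Finset.range (n + 1), a i * b (n - i), ?_⟩
    rw [iteratedDeriv_mul (hg.contDiffAt _) (hh.contDiffAt _)]
    push_cast
    rw [Finset.mul_sum]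
    refine Finset.sum_congr rfl fun i hi ↦ ?_
    rw [ha, hb, ← Nat.choose_mul_factorial_mul_factorial (Finset.mem_range_succ_iff.1 hi)]
    push_cast
    ring

/-- The ring of functions with integral Taylor coefficients. -/
def subring : Subring (ℂ → ℂ) where
  carrier := {h | HasIntTaylor h}
  mul_mem' := .mul
  one_mem' := by simpa using! intCast 1
  add_mem' := .add
  zero_mem' := by simpa using! intCast 0
  neg_mem' {h} hh := by
    have := (intCast (-1)).mul hh
    rwa [show (fun _ : ℂ ↦ ((-1 : ℤ) : ℂ)) * h = -h by ext; simp] at this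

/-- Locally uniform convergence of holomorphic functions passes to all derivatives, and ℤ is closed
in ℂ. Infinite Euler products thereby inherit integrality from finite ones. -/
lemma of_tendstoLocallyUniformlyOn {ι : Type*} {l : Filter ι} [l.NeBot] {F : ι → ℂ → ℂ}
    {h : ℂ → ℂ} (hF : ∀ i, HasIntTaylor (F i))
    (hlim : TendstoLocallyUniformlyOn F h l (Metric.ball 0 1)) : HasIntTaylor h where
  differentiableOn :=
    hlim.differentiableOn (.of_forall fun i ↦ (hF i).differentiableOn) Metric.isOpen_ball
  exists_int n := by
    have hd (i n) : DifferentiableOn ℂ (iteratedDeriv n (F i)) (Metric.ball 0 1) := by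
      induction n with
      | zero => simpa using (hF i).differentiableOn
      | succ n ih => rw [iteratedDeriv_succ]; exact ih.deriv Metric.isOpen_ball
    have hn (n : ℕ) : TendstoLocallyUniformlyOn (fun i ↦ iteratedDeriv n (F i))
        (iteratedDeriv n h) l (Metric.ball 0 1) := by
      induction n with
      | zero => simpa using hlim
      | succ n ih =>
        simp only [iteratedDeriv_succ]
        exact ih.deriv (.of_forall fun i ↦ hd i n) Metric.isOpen_ball
    have h0 := (hn n).tendsto_at (Metric.mem_ball_self one_pos)
    have hfac : (n ! : ℂ) ≠ 0 := by exact_mod_cast n.factorial_ne_zero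
    have hmem : iteratedDeriv n h 0 / n ! ∈ Set.range ((↑) : ℤ → ℂ) := by
      refine Complex.isClosed_range_intCast.mem_of_tendsto (h0.div_const _)
        (.of_forall fun i ↦ ?_)
      obtain ⟨m, hm⟩ := (hF i).exists_int n
      exact ⟨m, by rw [hm]; field_simp⟩
    obtain ⟨m, hm⟩ := hmem
    exact ⟨m, by rw [hm]; field_simp⟩

lemma eulerProd_comp {g : ℂ → ℂ} (hg : HasIntTaylor g)
    (hmap : Set.MapsTo g (Metric.ball 0 1) (Metric.ball 0 1)) :
    HasIntTaylor fun t ↦ eulerProd (g t) := by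
  have h := (ModularForm.multipliableLocallyUniformlyOn_one_sub_pow.hasProdLocallyUniformlyOn).comp
    g hmap hg.differentiableOn.continuousOn
  refine of_tendstoLocallyUniformlyOn (fun s ↦ ?_) h
  have : (∏ i ∈ s, (1 - g ^ (i + 1))) ∈ subring :=
    subring.prod_mem fun i _ ↦ subring.sub_mem subring.one_mem (subring.pow_mem hg _)
  convert (show HasIntTaylor _ from this) using 1
  ext t
  simp

lemma eq_zero_of_iteratedDeriv {h : ℂ → ℂ} (hd : DifferentiableOn ℂ h (Metric.ball 0 1))
    (h0 : ∀ n, iteratedDeriv n h 0 = 0) {t : ℂ} (ht : ‖t‖ < 1) : h t = 0 := by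
  have := Complex.hasSum_taylorSeries_on_ball (r := 1) hd (z := t) (by simpa using ht)
  simp only [h0, smul_zero] at this
  exact this.unique hasSum_zero

/-- A complex linear relation between functions with integral Taylor coefficients specializes to
integral relations. -/
lemma exists_int_relation {ι : Type*} (s : Finset ι) (c : ι → ℂ) (h : ι → ℂ → ℂ)
    (hh : ∀ i ∈ s, HasIntTaylor (h i))
    (hrel : ∀ t : ℂ, t ≠ 0 → ‖t‖ < 1 → ∑ i ∈ s, c i * h i t = 0) :
    ∃ (m : ι → ℤ) (D : ℤ), D ≠ 0 ∧ (∀ i ∈ s, c i = 0 → m i = 0) ∧ (∀ i ∈ s, c i = 1 → m i = D) ∧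
      ∀ t : ℂ, ‖t‖ < 1 → ∑ i ∈ s, m i * h i t = 0 := by
  classical
  have hsum (c : ι → ℂ) : DifferentiableOn ℂ (fun t ↦ ∑ i ∈ s, c i * h i t) (Metric.ball 0 1) :=
    DifferentiableOn.fun_sum fun i hi ↦ (hh i hi).differentiableOn.const_mul _
  have hder (c : ι → ℂ) (n : ℕ) : iteratedDeriv n (fun t ↦ ∑ i ∈ s, c i * h i t) 0 =
      ∑ i ∈ s, c i * iteratedDeriv n (h i) 0 := by
    rw [iteratedDeriv_fun_sum fun i hi ↦ contDiffAt_const.mul ((hh i hi).contDiffAt _)]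
    exact Finset.sum_congr rfl fun i hi ↦ iteratedDeriv_const_mul _ ((hh i hi).contDiffAt _)
  -- the relation holds on the whole disc
  have hzero (n : ℕ) : iteratedDeriv n (fun t ↦ ∑ i ∈ s, c i * h i t) 0 = 0 := by
    have hne : (fun t ↦ ∑ i ∈ s, c i * h i t) =ᶠ[𝓝[≠] 0] fun _ ↦ 0 := by
      filter_upwards [self_mem_nhdsWithin,
        mem_nhdsWithin_of_mem_nhds (Metric.ball_mem_nhds (0 : ℂ) one_pos)] with t ht ht'
      exact hrel t ht (by simpa using ht')
    have hev : (fun t ↦ ∑ i ∈ s, c i * h i t) =ᶠ[𝓝 0] fun _ ↦ 0 :=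
      (ContinuousAt.eventuallyEq_nhds_iff_eventuallyEq_nhdsNE
        ((hsum c).differentiableAt (Metric.ball_mem_nhds _ one_pos)).continuousAt
        continuousAt_const).1 hne
    rw [hev.iteratedDeriv_eq n]
    simp
  -- A ℚ-linear retraction of ℂ onto ℚ. Each Taylor coefficient gives an integral linear condition
  -- on the `c i`, which `L` preserves; it also fixes 0 and 1. A common denominator `b` of the
  -- values then serves as `D`.
  obtain ⟨L, hL⟩ := (Algebra.linearMap ℚ ℂ).exists_leftInverse_of_injective
    (LinearMap.ker_eq_bot.2 (algebraMap ℚ ℂ).injective)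
  have hL1 : L 1 = 1 := by
    have := LinearMap.congr_fun hL 1
    simpa using this
  obtain ⟨b, hb⟩ := IsLocalization.exist_integer_multiples_of_finset (nonZeroDivisors ℤ)
    (s.image fun i ↦ L (c i))
  have hb' : ∀ i, ∃ m : ℤ, i ∈ s → (m : ℚ) = (b : ℤ) * L (c i) := by
    intro i
    by_cases hi : i ∈ s
    · obtain ⟨m, hm⟩ := hb _ (Finset.mem_image_of_mem _ hi)
      exact ⟨m, fun _ ↦ by simpa using hm⟩
    · exact ⟨0, fun h ↦ absurd h hi⟩
  choose m hm using hb'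
  refine ⟨m, b, nonZeroDivisors.coe_ne_zero b, fun i hi h0 ↦ ?_, fun i hi h1 ↦ ?_, fun t ht ↦ ?_⟩
  · have := hm i hi
    rw [h0, map_zero, mul_zero] at this
    exact_mod_cast this
  · have := hm i hi
    rw [h1, hL1, mul_one] at this
    exact_mod_cast this
  · refine eq_zero_of_iteratedDeriv (h := fun t ↦ ∑ i ∈ s, (m i : ℂ) * h i t) (hsum _)
      (fun n ↦ ?_) ht
    have hn := hzero n
    rw [hder] at hn ⊢
    have hex : ∀ i, ∃ a : ℤ, i ∈ s → iteratedDeriv n (h i) 0 = n ! * a := by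
      intro i
      by_cases hi : i ∈ s
      · obtain ⟨a, ha⟩ := (hh i hi).exists_int n
        exact ⟨a, fun _ ↦ ha⟩
      · exact ⟨0, fun h ↦ absurd h hi⟩
    choose a ha using hex
    have e1 : ∑ i ∈ s, (a i : ℚ) • c i = 0 := by
      have hfac : (n ! : ℂ) ≠ 0 := by exact_mod_cast n.factorial_ne_zero
      apply mul_left_cancel₀ hfac
      rw [mul_zero, ← hn, Finset.mul_sum]
      refine Finset.sum_congr rfl fun i hi ↦ ?_
      rw [ha i hi, Rat.smul_def]
      push_cast
      ring
    have e2 : ∑ i ∈ s, (m i : ℚ) * a i = 0 := by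
      have := congrArg L e1
      rw [map_sum, map_zero] at this
      simp only [map_smul, smul_eq_mul] at this
      calc ∑ i ∈ s, (m i : ℚ) * a i = (b : ℤ) * ∑ i ∈ s, (a i : ℚ) * L (c i) := by
            rw [Finset.mul_sum]
            refine Finset.sum_congr rfl fun i hi ↦ ?_
            rw [hm i hi]; ring
        _ = 0 := by rw [this, mul_zero]
    have e3 : ∑ i ∈ s, (m i : ℂ) * a i = 0 := by exact_mod_cast e2
    calc ∑ i ∈ s, (m i : ℂ) * iteratedDeriv n (h i) 0
        = n ! * ∑ i ∈ s, (m i : ℂ) * a i := by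
          rw [Finset.mul_sum]
          refine Finset.sum_congr rfl fun i hi ↦ ?_
          rw [ha i hi]; ring
      _ = 0 := by rw [e3, mul_zero]

end HasIntTaylor

lemma mapsTo_pow_unit_ball {n : ℕ} (hn : n ≠ 0) (σ : ℂ) (hσ : ‖σ‖ = 1) :
    Set.MapsTo (fun t : ℂ ↦ σ * t ^ n) (Metric.ball 0 1) (Metric.ball 0 1) := by
  intro t ht
  rw [mem_ball_zero_iff] at ht ⊢
  rw [norm_mul, hσ, one_mul]
  exact norm_pow_lt_one ht hn

/-- Numerator of `weberF` as a function of the local parameter. -/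
noncomputable def weberNum (t : ℂ) : ℂ := eulerProd (-t ^ 24)

/-- Denominator of `weberF` as a function of the local parameter. -/
noncomputable def weberDen (t : ℂ) : ℂ := t * eulerProd (t ^ 48)

lemma weberF_eq_div (τ : ℂ) : weberF τ = weberNum (cuspParam τ) / weberDen (cuspParam τ) :=
  weberF_eq τ

lemma weberDen_ne_zero {t : ℂ} (h0 : t ≠ 0) (ht : ‖t‖ < 1) : weberDen t ≠ 0 :=
  mul_ne_zero h0 (eulerProd_ne_zero (norm_pow_lt_one ht (by norm_num)))

lemma hasIntTaylor_weberNum_comp {n : ℕ} (hn : n ≠ 0) : HasIntTaylor fun t ↦ weberNum (t ^ n) := by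
  unfold weberNum
  apply HasIntTaylor.eulerProd_comp (g := fun t ↦ -(t ^ n) ^ 24)
  · exact HasIntTaylor.subring.neg_mem (HasIntTaylor.subring.pow_mem
      (HasIntTaylor.subring.pow_mem HasIntTaylor.id n) 24)
  · have := mapsTo_pow_unit_ball (mul_ne_zero hn (show 24 ≠ 0 by norm_num)) (-1) (by simp)
    simpa [pow_mul] using this

lemma hasIntTaylor_weberDen_comp {n : ℕ} (hn : n ≠ 0) : HasIntTaylor fun t ↦ weberDen (t ^ n) := by
  unfold weberDen
  have h1 : HasIntTaylor fun t ↦ eulerProd ((t ^ n) ^ 48) := by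
    apply HasIntTaylor.eulerProd_comp (g := fun t ↦ (t ^ n) ^ 48)
    · exact HasIntTaylor.subring.pow_mem (HasIntTaylor.subring.pow_mem HasIntTaylor.id n) 48
    · have := mapsTo_pow_unit_ball (mul_ne_zero hn (show 48 ≠ 0 by norm_num)) 1 (by simp)
      simpa [pow_mul] using this
  have h2 : HasIntTaylor fun t ↦ t ^ n := HasIntTaylor.subring.pow_mem HasIntTaylor.id n
  exact h2.mul h1

lemma exists_cuspParam_eq {t : ℂ} (h0 : t ≠ 0) (ht : ‖t‖ < 1) : ∃ τ : ℍ, cuspParam τ = t :=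
  ⟨⟨Function.Periodic.invQParam 48 t,
    Function.Periodic.im_invQParam_pos_of_norm_lt_one (by norm_num) ht h0⟩,
    Function.Periodic.qParam_right_inv (by norm_num) h0⟩

lemma evalEval_eq_sum {R : Type*} [CommSemiring R] (P : R[X][X]) {A B : ℕ} (hB : P.natDegree < B)
    (hA : ∀ j, (P.coeff j).natDegree < A) (x y : R) : P.evalEval x y =
      ∑ p ∈ Finset.range A ×ˢ Finset.range B, (P.coeff p.2).coeff p.1 * (x ^ p.1 * y ^ p.2) := by
  rw [Finset.sum_product_right, evalEval, eval_eq_sum_range' hB, eval_finsetSum]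
  refine Finset.sum_congr rfl fun j _ ↦ ?_
  rw [eval_mul, eval_pow, eval_C, eval_eq_sum_range' (hA j), Finset.sum_mul]
  exact Finset.sum_congr rfl fun i _ ↦ by ring

/-- From a monic complex relation between `weberF τ` and `weberF (ℓτ)` we obtain an integral one,
of the same degree and with constant leading coefficient. -/
theorem exists_int_polynomial {ℓ : ℕ} (hℓ : ℓ ≠ 0) {P : ℂ[X][X]} (hP : P.Monic)
    (hrel : ∀ τ : ℍ, P.evalEval (weberF τ) (weberF (ℓ * τ)) = 0) :
    ∃ (Q : ℤ[X][X]) (D : ℤ), D ≠ 0 ∧ Q.natDegree = P.natDegree ∧ Q.leadingCoeff = C D ∧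
      ∀ τ : ℍ, aevalAeval (weberF τ) (weberF (ℓ * τ)) Q = 0 := by
  set d := P.natDegree with hd
  obtain ⟨A, hA⟩ : ∃ A, ∀ j, (P.coeff j).natDegree < A := by
    refine ⟨(Finset.range (d + 1)).sup (fun j ↦ (P.coeff j).natDegree) + 1, fun j ↦ ?_⟩
    rw [Nat.lt_succ_iff]
    by_cases hj : j ∈ Finset.range (d + 1)
    · exact Finset.le_sup (f := fun j ↦ (P.coeff j).natDegree) hj
    · rw [coeff_eq_zero_of_natDegree_lt (by simpa using hj)]; simp
  -- The monomials in f(τ) and f(ℓτ) times one common denominator. The truncated subtractions are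
  -- exact on the index set, where p.1 < A and p.2 < d + 1.
  let h : ℕ × ℕ → ℂ → ℂ := fun p t ↦ weberNum (t ^ 1) ^ p.1 * weberDen (t ^ 1) ^ (A - p.1) *
    (weberNum (t ^ ℓ) ^ p.2 * weberDen (t ^ ℓ) ^ (d + 1 - p.2))
  have hh (p) : HasIntTaylor (h p) := by
    have a1 := HasIntTaylor.subring.pow_mem (hasIntTaylor_weberNum_comp one_ne_zero) p.1
    have a2 := HasIntTaylor.subring.pow_mem (hasIntTaylor_weberDen_comp one_ne_zero) (A - p.1)
    have a3 := HasIntTaylor.subring.pow_mem (hasIntTaylor_weberNum_comp hℓ) p.2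
    have a4 := HasIntTaylor.subring.pow_mem (hasIntTaylor_weberDen_comp hℓ) (d + 1 - p.2)
    exact HasIntTaylor.subring.mul_mem (HasIntTaylor.subring.mul_mem a1 a2)
      (HasIntTaylor.subring.mul_mem a3 a4)
  -- clearing denominators
  have hclear (τ : ℍ) (p : ℕ × ℕ) (hp : p ∈ Finset.range A ×ˢ Finset.range (d + 1)) :
      h p (cuspParam τ) = (weberDen (cuspParam τ) ^ A * weberDen (cuspParam τ ^ ℓ) ^ (d + 1)) *
        (weberF τ ^ p.1 * weberF (ℓ * τ) ^ p.2) := by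
    rw [Finset.mem_product, Finset.mem_range, Finset.mem_range] at hp
    have n1 := weberDen_ne_zero (cuspParam_ne_zero τ) (norm_cuspParam_lt_one τ.im_pos)
    have n2 := weberDen_ne_zero (pow_ne_zero ℓ (cuspParam_ne_zero τ))
      (norm_pow_lt_one (norm_cuspParam_lt_one τ.im_pos) hℓ)
    simp only [h, weberF_eq_div, cuspParam_natCast_mul, pow_one, div_pow]
    rw [pow_sub₀ _ n1 hp.1.le, pow_sub₀ _ n2 hp.2.le]
    field_simp
  have hsum : ∀ t : ℂ, t ≠ 0 → ‖t‖ < 1 → ∑ p ∈ Finset.range A ×ˢ Finset.range (d + 1),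
      (P.coeff p.2).coeff p.1 * h p t = 0 := by
    intro t h0 ht
    obtain ⟨τ, rfl⟩ := exists_cuspParam_eq h0 ht
    have := hrel τ
    rw [evalEval_eq_sum P (Nat.lt_succ_self _) hA] at this
    calc _ = (weberDen (cuspParam τ) ^ A * weberDen (cuspParam τ ^ ℓ) ^ (d + 1)) *
        ∑ p ∈ Finset.range A ×ˢ Finset.range (d + 1), (P.coeff p.2).coeff p.1 *
          (weberF τ ^ p.1 * weberF (ℓ * τ) ^ p.2) := by
          rw [Finset.mul_sum]
          refine Finset.sum_congr rfl fun p hp ↦ ?_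
          rw [hclear τ p hp]; ring
      _ = 0 := by rw [this, mul_zero]
  obtain ⟨m, D, hD, hm0, hm1, hm⟩ := HasIntTaylor.exists_int_relation _
    (fun p : ℕ × ℕ ↦ (P.coeff p.2).coeff p.1) h (fun p _ ↦ hh p) hsum
  let q : ℕ → ℤ[X] := fun j ↦ ∑ i ∈ Finset.range A, C (m (i, j)) * X ^ i
  let Q : ℤ[X][X] := ∑ j ∈ Finset.range (d + 1), C (q j) * X ^ j
  have hQc (j : ℕ) : Q.coeff j = if j < d + 1 then q j else 0 := by
    simp [Q, coeff_X_pow]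
  -- Monicity survives as a constant leading coefficient, since zero coefficients stay zero and 1
  -- becomes `D`.
  have hqd : q d = C D := by
    have hA0 : 0 ∈ Finset.range A := Finset.mem_range.2 (Nat.zero_lt_of_lt (hA 0))
    have hlc : P.coeff d = 1 := hP.coeff_natDegree
    change ∑ i ∈ Finset.range A, C (m (i, d)) * X ^ i = C D
    rw [← Finset.sum_erase_add _ _ hA0, Finset.sum_eq_zero, zero_add, pow_zero, mul_one,
      hm1 (0, d) (by simpa using Finset.mem_range.1 hA0) (by simp [hlc])]
    intro i hi
    rw [Finset.mem_erase] at hi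
    rw [hm0 (i, d) (by simpa using Finset.mem_range.1 hi.2)
      (by simp [hlc, coeff_one, hi.1]), C_0, zero_mul]
  have hQd : Q.coeff d = C D := by rw [hQc, if_pos (Nat.lt_succ_self d), hqd]
  have hdeg : Q.natDegree = d := by
    refine natDegree_eq_of_le_of_coeff_ne_zero ?_ ?_
    · rw [natDegree_le_iff_coeff_eq_zero]
      intro j hj
      rw [hQc, if_neg (by omega)]
    · rw [hQd]; simpa using hD
  refine ⟨Q, D, hD, hdeg, by rw [leadingCoeff, hdeg, hQd], fun τ ↦ ?_⟩
  have hne : weberDen (cuspParam τ) ^ A * weberDen (cuspParam τ ^ ℓ) ^ (d + 1) ≠ 0 := by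
    refine mul_ne_zero (pow_ne_zero _ ?_) (pow_ne_zero _ ?_)
    · exact weberDen_ne_zero (cuspParam_ne_zero τ) (norm_cuspParam_lt_one τ.im_pos)
    · exact weberDen_ne_zero (pow_ne_zero ℓ (cuspParam_ne_zero τ))
        (norm_pow_lt_one (norm_cuspParam_lt_one τ.im_pos) hℓ)
  apply mul_left_cancel₀ hne
  rw [mul_zero, ← hm _ (norm_cuspParam_lt_one τ.im_pos)]
  rw [Finset.sum_product_right, map_sum, Finset.mul_sum]
  refine Finset.sum_congr rfl fun j hj ↦ ?_
  rw [map_mul, map_pow, aevalAeval_C, map_sum, Finset.sum_mul, Finset.mul_sum]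
  refine Finset.sum_congr rfl fun i hi ↦ ?_
  rw [hclear τ (i, j) (Finset.mem_product.2 ⟨hi, hj⟩)]
  simp
  ring

end

/-! ### The conjugates of f(ℓτ) and their permutation by the theta group -/

section

open Filter Topology
open scoped MatrixGroups Manifold
open ModularGroup (S T)

section Conjugates

variable {ℓ : ℕ}

/-- The point `ℓτ`. -/
noncomputable def mulPoint (hℓ : 0 < ℓ) (τ : ℍ) : ℍ :=
  ⟨ℓ * τ, by simpa using mul_pos (Nat.cast_pos.2 hℓ) τ.im_pos⟩

/-- The point `(τ + r) / ℓ`. -/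
noncomputable def divPoint (hℓ : 0 < ℓ) (r : ℤ) (τ : ℍ) : ℍ :=
  ⟨(τ + r) / ℓ, by
    simpa [Complex.div_natCast_im] using div_pos τ.im_pos (Nat.cast_pos.2 hℓ)⟩

lemma coe_mulPoint (hℓ : 0 < ℓ) (τ : ℍ) : (mulPoint hℓ τ : ℂ) = ℓ * τ := rfl

lemma coe_divPoint (hℓ : 0 < ℓ) (r : ℤ) (τ : ℍ) : (divPoint hℓ r τ : ℂ) = (τ + r) / ℓ := rfl

lemma tendsto_mulPoint (hℓ : 0 < ℓ) : Tendsto (mulPoint hℓ) atImInfty atImInfty := by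
  rw [atImInfty, tendsto_comap_iff]
  have : Tendsto (fun τ : ℍ ↦ (ℓ : ℝ) * τ.im) atImInfty atTop :=
    Tendsto.const_mul_atTop (Nat.cast_pos.2 hℓ) tendsto_comap
  refine this.congr fun τ ↦ ?_
  rw [Function.comp_apply, ← coe_im, ← coe_im, coe_mulPoint]
  simp

lemma tendsto_divPoint (hℓ : 0 < ℓ) (r : ℤ) : Tendsto (divPoint hℓ r) atImInfty atImInfty := by
  rw [atImInfty, tendsto_comap_iff]
  have : Tendsto (fun τ : ℍ ↦ τ.im / ℓ) atImInfty atTop :=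
    Tendsto.atTop_div_const (Nat.cast_pos.2 hℓ) tendsto_comap
  refine this.congr fun τ ↦ ?_
  rw [Function.comp_apply, ← coe_im, ← coe_im, coe_divPoint, Complex.div_natCast_im]
  simp

/-- The conjugates of `weberF (ℓτ)` over the field generated by `weberF`. -/
noncomputable def weberConj (ℓ : ℕ) (i : Option (ZMod ℓ)) (τ : ℂ) : ℂ :=
  i.elim (weberF (ℓ * τ)) fun k ↦ weberF ((τ + (48 * k.val : ℤ)) / ℓ)

lemma cuspParam_add_forty_eight_mul (τ : ℂ) (n : ℤ) :
    cuspParam (τ + (48 * n : ℤ)) = cuspParam τ := by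
  rw [cuspParam_def, cuspParam_def, Complex.exp_eq_exp_iff_exists_int]
  exact ⟨n, by push_cast; ring⟩

lemma weberConj_none (τ : ℂ) : weberConj ℓ none τ = weberF (ℓ * τ) := rfl

lemma weberConj_some (k : ZMod ℓ) (τ : ℂ) :
    weberConj ℓ (some k) τ = weberF ((τ + (48 * k.val : ℤ)) / ℓ) := rfl

/-- The period 48 of `weberF` makes the shift by 48n depend only on n modulo ℓ, so the
representative `val` is immaterial. -/
lemma weberConj_intCast (hℓ : 0 < ℓ) (n : ℤ) (τ : ℂ) :
    weberConj ℓ (some (n : ZMod ℓ)) τ = weberF ((τ + (48 * n : ℤ)) / ℓ) := by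
  have : NeZero ℓ := ⟨hℓ.ne'⟩
  have h : (ℓ : ℤ) ∣ n - ((n : ZMod ℓ).val : ℤ) := by
    rw [← ZMod.intCast_eq_intCast_iff_dvd_sub]; simp
  obtain ⟨m, hm⟩ := h
  have hn : n = (n : ZMod ℓ).val + ℓ * m := by linarith
  rw [weberConj_some]
  conv_rhs => rw [hn]
  rw [← weberF_add_forty_eight_mul _ m]
  congr 1
  have : (ℓ : ℂ) ≠ 0 := by exact_mod_cast hℓ.ne'
  push_cast
  field_simp
  ring

lemma sq_sub_one_of_coprime (hN : ℓ.Coprime 48) : ∃ u : ℤ, (ℓ : ℤ) ^ 2 = 1 + 24 * u := by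
  have h2 : Nat.Coprime ℓ 2 := hN.coprime_dvd_right (by norm_num)
  have h3 : Nat.Coprime ℓ 3 := hN.coprime_dvd_right (by norm_num)
  have hodd : ¬ 2 ∣ ℓ := fun h ↦ by
    have := Nat.Coprime.eq_one_of_dvd h2.symm h; omega
  have hthree : ¬ 3 ∣ ℓ := fun h ↦ by
    have := Nat.Coprime.eq_one_of_dvd h3.symm h; omega
  have h24 : ((ℓ : ZMod 24)) ^ 2 = 1 := by
    have key : ∀ x : ZMod 24, x.val % 2 ≠ 0 → x.val % 3 ≠ 0 → x ^ 2 = 1 := by decide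
    apply key
    · rw [ZMod.val_natCast]; omega
    · rw [ZMod.val_natCast]; omega
  have : (24 : ℤ) ∣ (ℓ : ℤ) ^ 2 - 1 := by
    refine (ZMod.intCast_zmod_eq_zero_iff_dvd _ 24).1 ?_
    push_cast
    rw [h24, sub_self]
  obtain ⟨u, hu⟩ := this
  exact ⟨u, by linarith⟩

/-- The permutation of the conjugates induced by `T ^ 2`. -/
def conjShift (m : ZMod ℓ) : Equiv.Perm (Option (ZMod ℓ)) := Equiv.optionCongr (Equiv.addRight m)

/-- With ℓ² = 1 + 24u one has 2 = 2ℓ² - 48u, so (τ + 2 + 48k)/ℓ = (τ + 48(k - u))/ℓ + 2ℓ. Hence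
every conjugate acquires the same multiplier as f(ℓτ). -/
lemma exists_weberConj_T_sq (hℓ : 0 < ℓ) (hN : ℓ.Coprime 48) :
    ∃ σ : Equiv.Perm (Option (ZMod ℓ)), ∀ i (τ : ℍ),
      weberConj ℓ i (T ^ (2 : ℤ) • τ : ℍ) = zeta24 ^ (-ℓ : ℤ) * weberConj ℓ (σ i) τ := by
  obtain ⟨u, hu⟩ := sq_sub_one_of_coprime hN
  have hℓ0 : (ℓ : ℂ) ≠ 0 := by exact_mod_cast hℓ.ne'
  refine ⟨conjShift ((-u : ℤ) : ZMod ℓ), fun i τ ↦ ?_⟩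
  rw [coe_T_zpow_smul]
  rcases i with _ | k
  · change weberF _ = _ * weberF _
    rw [← weberF_add_two_mul]
    congr 1; push_cast; ring
  · have hk : conjShift ((-u : ℤ) : ZMod ℓ) (some k) = some (((k.val + -u : ℤ)) : ZMod ℓ) := by
      have : NeZero ℓ := ⟨hℓ.ne'⟩
      simp [conjShift]
    rw [hk, weberConj_intCast hℓ, weberConj_some, ← weberF_add_two_mul]
    congr 1
    have hu' : (ℓ : ℂ) ^ 2 = 1 + 24 * u := by exact_mod_cast hu
    field_simp
    push_cast
    linear_combination (-2 : ℂ) * hu'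

/-- The matrix with rows `(a, b)` and `(c, d)`. -/
def mkSL2 {a b c d : ℤ} (h : a * d - b * c = 1) : SL(2, ℤ) :=
  ⟨!![a, b; c, d], by rw [Matrix.det_fin_two_of]; exact h⟩

lemma coe_mkSL2 {a b c d : ℤ} (h : a * d - b * c = 1) :
    (mkSL2 h : Matrix (Fin 2) (Fin 2) ℤ) = !![a, b; c, d] := rfl

/-- Moves `S` past division by ℓ: a suitable integral matrix exists whenever NN' ≡ -1 mod ℓ. -/
lemma smul_divPoint (hℓ : 0 < ℓ) {N N' b : ℤ} (h : N * -N' - b * ℓ = 1) (τ : ℍ) :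
    (mkSL2 h • divPoint hℓ N' τ : ℍ) = (-1 / (τ : ℂ) + N) / ℓ := by
  have hℓ0 : (ℓ : ℂ) ≠ 0 := by exact_mod_cast hℓ.ne'
  have hτ := ne_zero τ
  rw [coe_specialLinearGroup_apply, coe_divPoint]
  have h' : (N : ℂ) * -N' - b * ℓ = 1 := by exact_mod_cast h
  simp only [coe_mkSL2, Matrix.of_apply, Matrix.cons_val', Matrix.cons_val_zero,
    Matrix.cons_val_fin_one, Matrix.cons_val_one, algebraMap_int_eq, eq_intCast,
    Complex.ofReal_intCast]
  have hden : ((ℓ : ℤ) : ℂ) * ((τ + N') / ℓ) + ((-N' : ℤ) : ℂ) = τ := by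
    push_cast
    field_simp
    ring
  rw [hden]
  field_simp
  linear_combination -h'

/-- The involution of the conjugates induced by `S`. -/
noncomputable def conjInv (ℓ : ℕ) [Fact ℓ.Prime] : Option (ZMod ℓ) → Option (ZMod ℓ)
  | none => some 0
  | some k => if k = 0 then none else some (-(48 ^ 2 * k)⁻¹)

lemma forty_eight_ne_zero [Fact ℓ.Prime] (hN : ℓ.Coprime 48) : (48 : ZMod ℓ) ≠ 0 := by
  have := (ZMod.isUnit_iff_coprime 48 ℓ).2 hN.symm
  exact_mod_cast this.ne_zero

lemma conjInv_involutive [Fact ℓ.Prime] (hN : ℓ.Coprime 48) :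
    Function.Involutive (conjInv ℓ) := by
  have h48 := forty_eight_ne_zero hN
  rintro (_ | k)
  · simp [conjInv]
  · by_cases hk : k = 0
    · simp [conjInv, hk]
    · simp only [conjInv, hk, if_false]
      rw [if_neg (by simp [hk, h48])]
      congr 1
      field_simp

lemma weberConj_S (hN : ℓ.Coprime 48) [Fact ℓ.Prime] (i : Option (ZMod ℓ)) (τ : ℍ) :
    weberConj ℓ i (S • τ : ℍ) = weberConj ℓ (conjInv ℓ i) τ := by
  have hℓ : 0 < ℓ := (Fact.out : ℓ.Prime).pos
  have hℓ0 : (ℓ : ℂ) ≠ 0 := by exact_mod_cast hℓ.ne'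
  have hτ := ne_zero τ
  rw [coe_S_smul]
  rcases i with _ | k
  · change weberF _ = weberConj ℓ (some 0) τ
    have h0 := weberConj_intCast hℓ 0 τ
    rw [Int.cast_zero] at h0
    rw [h0]
    have h1 := weberF_neg_inv (τ := (divPoint hℓ 0 τ : ℂ)) (divPoint hℓ 0 τ).im_pos
    rw [coe_divPoint] at h1
    simp only [Int.cast_zero, add_zero, mul_zero] at h1 ⊢
    rw [← h1]
    congr 1; field_simp
  · by_cases hk : k = 0
    · have h1 := weberF_neg_inv (τ := (mulPoint hℓ τ : ℂ)) (mulPoint hℓ τ).im_pos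
      rw [coe_mulPoint] at h1
      simp only [conjInv, hk, if_true, weberConj_none]
      rw [← h1, weberConj_some]
      congr 1; simp; field_simp
    · simp only [conjInv, hk, if_false]
      have h48 := forty_eight_ne_zero hN
      set k' : ZMod ℓ := -(48 ^ 2 * k)⁻¹ with hk'
      -- The definition of `conjInv` is chosen for this congruence; both diagonal entries of the
      -- resulting matrix are divisible by 48.
      have hdvd : (ℓ : ℤ) ∣ (48 * k.val) * (48 * k'.val) + 1 := by
        rw [← ZMod.intCast_zmod_eq_zero_iff_dvd]
        push_cast
        rw [ZMod.natCast_zmod_val, ZMod.natCast_zmod_val, hk']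
        field_simp
        ring
      obtain ⟨b, hb⟩ := hdvd
      have hdet : (48 * k.val : ℤ) * -(48 * k'.val : ℤ) - (-b) * ℓ = 1 := by linarith
      have key := smul_divPoint hℓ hdet τ
      rw [weberConj_some, weberConj_some, ← coe_divPoint hℓ, ← key]
      apply weberF_smul_of_dvd
      · simp [coe_mkSL2]
      · simp [coe_mkSL2]

/-- `S` carries f(ℓτ) to the conjugate with index 0, and T^(48k) carries that one to index k, while
f(τ) is fixed by both. -/
lemma weberConj_isRoot_relation [Fact ℓ.Prime] (hN : ℓ.Coprime 48) {A : Type*} [CommRing A]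
    [Algebra A ℂ] {P : A[X][X]}
    (h : ∀ τ : ℍ, aevalAeval (weberF τ) (weberF (ℓ * τ)) P = 0) (i : Option (ZMod ℓ)) (τ : ℍ) :
    aevalAeval (weberF τ) (weberConj ℓ i τ) P = 0 := by
  have hℓ : 0 < ℓ := (Fact.out : ℓ.Prime).pos
  rcases i with _ | k
  · exact h τ
  · have h0 (τ : ℍ) : aevalAeval (weberF τ) (weberConj ℓ (some 0) τ) P = 0 := by
      have h1 := h (S • τ)
      rw [← weberConj_none, weberConj_S hN, coe_S_smul, weberF_neg_inv τ.im_pos] at h1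
      exact h1
    have h1 := h0 (T ^ (48 * k.val : ℤ) • τ)
    have h2 := weberConj_intCast hℓ 0 (T ^ (48 * k.val : ℤ) • τ : ℍ)
    rw [Int.cast_zero] at h2
    have h3 := weberF_add_forty_eight_mul τ k.val
    rw [h2, coe_T_zpow_smul] at h1
    rw [weberConj_some]
    push_cast at h1 h3 ⊢
    rw [h3] at h1
    simpa using h1

lemma isBoundedAtImInfty_weberF_TS :
    IsBoundedAtImInfty fun τ : ℍ ↦ weberF ((T * S) • τ : ℍ) :=
  isRegularAwayFromInfty_weberF.bounded

lemma isBoundedAtImInfty_of_eq_smul {G : ℍ → ℂ} {γ : SL(2, ℤ)} {p : ℍ → ℍ}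
    (hγ : Even (γ 0 0 + γ 1 0)) (hp : Tendsto p atImInfty atImInfty)
    (h : ∀ τ, G τ = weberF (γ • p τ : ℍ)) : IsBoundedAtImInfty G := by
  obtain ⟨e, he⟩ := exists_weberF_smul_of_even hγ
  have h1 : (fun τ ↦ weberF ((T * S) • p τ : ℍ)) =O[atImInfty] (1 : ℍ → ℝ) :=
    isBoundedAtImInfty_weberF_TS.comp_tendsto hp
  exact (h1.const_mul_left (zeta24 ^ e)).congr_left fun τ ↦ by rw [h, he]

lemma coe_T_zpow_mul_S_smul (n : ℤ) (τ : ℍ) :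
    ((T ^ n * S) • τ : ℍ) = (n : ℂ) + -1 / τ := by
  rw [mul_smul, coe_T_zpow_smul, coe_S_smul, add_comm]

lemma even_T_zpow_mul_S {n : ℤ} (hn : Odd n) :
    Even ((T ^ n * S : SL(2, ℤ)) 0 0 + (T ^ n * S : SL(2, ℤ)) 1 0) := by
  simpa [ModularGroup.coe_T_zpow, ModularGroup.coe_S] using hn.add_one

lemma odd_of_coprime (hN : ℓ.Coprime 48) : Odd (ℓ : ℤ) := by
  have h2 : Nat.Coprime ℓ 2 := hN.coprime_dvd_right (by norm_num)
  exact_mod_cast Nat.coprime_two_right.1 h2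

/-- At the cusp 1 each conjugate becomes `weberF` at γ applied to a rescaled point, where γ sends i∞
to an odd/odd fraction because ℓ and 1 + 48k are odd. -/
lemma isRegularAwayFromInfty_weberConj [Fact ℓ.Prime] (hN : ℓ.Coprime 48)
    (i : Option (ZMod ℓ)) : IsRegularAwayFromInfty fun τ : ℍ ↦ weberConj ℓ i τ := by
  have hℓ : 0 < ℓ := (Fact.out : ℓ.Prime).pos
  have hℓ0 : (ℓ : ℂ) ≠ 0 := by exact_mod_cast hℓ.ne'
  have hodd := odd_of_coprime hN
  rcases i with _ | k
  · refine ⟨?_, ⟨ℓ, ?_⟩, ?_⟩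
    · exact mdifferentiable_weberF_comp (g := fun z ↦ ℓ * z) (by fun_prop)
        fun z hz ↦ (mulPoint hℓ ⟨z, hz⟩).im_pos
    · refine ((tendsto_weberF_mul_cuspParam.comp (tendsto_mulPoint hℓ)).isBigO_one ℝ).congr_left
        fun τ ↦ ?_
      rw [Function.comp_apply, coe_mulPoint, weberConj_none, cuspParam_natCast_mul]
    · refine isBoundedAtImInfty_of_eq_smul (even_T_zpow_mul_S hodd) (tendsto_divPoint hℓ 0)
        fun τ ↦ ?_
      rw [coe_TS_smul, coe_T_zpow_mul_S_smul, coe_divPoint, weberConj_none]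
      congr 1
      have := ne_zero τ
      push_cast
      rw [add_zero]
      field_simp
  · refine ⟨?_, ⟨1, ?_⟩, ?_⟩
    · exact mdifferentiable_weberF_comp (g := fun z ↦ (z + (48 * k.val : ℤ)) / ℓ) (by fun_prop)
        fun z hz ↦ (divPoint hℓ (48 * k.val) ⟨z, hz⟩).im_pos
    · have h1 := (tendsto_weberF_mul_cuspParam.mul (tendsto_cuspParam.pow (ℓ - 1))).comp
        (tendsto_divPoint hℓ (48 * k.val))
      refine (h1.isBigO_one ℝ).congr_left fun τ ↦ ?_
      have h2 : cuspParam τ = cuspParam (divPoint hℓ (48 * k.val) τ) ^ ℓ := by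
        rw [← cuspParam_natCast_mul, coe_divPoint, mul_div_cancel₀ _ hℓ0,
          cuspParam_add_forty_eight_mul]
      rw [Function.comp_apply, pow_one, h2, weberConj_some, ← coe_divPoint hℓ, mul_assoc,
        ← pow_succ', Nat.sub_add_cancel hℓ]
    · set N : ℤ := 1 + 48 * k.val with hNdef
      have hNodd : Odd N := ⟨24 * k.val, by rw [hNdef]; ring⟩
      have hval (τ : ℍ) : weberConj ℓ (some k) ((T * S) • τ : ℍ) = weberF ((-1 / (τ : ℂ) + N) / ℓ) := by
        rw [weberConj_some, coe_TS_smul, hNdef]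
        congr 1; push_cast; ring
      -- If N = ℓu, the point is T^u S applied to ℓτ; otherwise N is invertible modulo ℓ and
      -- `smul_divPoint` applies.
      by_cases hdvd : (ℓ : ℤ) ∣ N
      · obtain ⟨u, hu⟩ := hdvd
        have huodd : Odd u := (Int.odd_mul.1 (hu ▸ hNodd)).2
        refine isBoundedAtImInfty_of_eq_smul (even_T_zpow_mul_S huodd) (tendsto_mulPoint hℓ)
          fun τ ↦ ?_
        rw [hval, coe_T_zpow_mul_S_smul, coe_mulPoint, hu]
        congr 1
        have := ne_zero τ
        push_cast
        field_simp
        ring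
      · have hN0 : (N : ZMod ℓ) ≠ 0 := by
          rwa [Ne, ZMod.intCast_zmod_eq_zero_iff_dvd]
        have hdvd' : (ℓ : ℤ) ∣ N * (-(N : ZMod ℓ)⁻¹).val + 1 := by
          rw [← ZMod.intCast_zmod_eq_zero_iff_dvd]
          push_cast
          rw [ZMod.natCast_zmod_val]
          field_simp
          ring
        obtain ⟨b, hb⟩ := hdvd'
        have hdet : N * -((-(N : ZMod ℓ)⁻¹).val : ℤ) - (-b) * ℓ = 1 := by linarith
        refine isBoundedAtImInfty_of_eq_smul
          (γ := mkSL2 hdet)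
          (by simpa [coe_mkSL2] using hNodd.add_odd hodd)
          (tendsto_divPoint hℓ (-(N : ZMod ℓ)⁻¹).val) fun τ ↦ ?_
        rw [hval, smul_divPoint hℓ hdet]

end Conjugates

end

/-! ### The monic complex relation and minimality of its degree -/

section

open Filter Topology
open scoped MatrixGroups Manifold
open ModularGroup (S T)

section Relation

variable {ℓ : ℕ}

lemma Polynomial.scaleRoots_prod_X_sub_C {R ι : Type*} [CommRing R] [IsDomain R] (s : Finset ι) (a : ι → R)
    (r : R) : (∏ i ∈ s, (X - C (a i))).scaleRoots r = ∏ i ∈ s, (X - C (r * a i)) := by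
  classical
  induction s using Finset.induction_on with
  | empty => simp [one_scaleRoots]
  | insert i s hi ih =>
    rw [Finset.prod_insert hi, Finset.prod_insert hi, mul_scaleRoots_of_noZeroDivisors, ih,
      X_sub_C_scaleRoots, mul_comm (a i)]

/-- The polynomial whose roots are the values at `τ` of the conjugates of `weberF (ℓτ)`. -/
noncomputable def conjPoly (ℓ : ℕ) [NeZero ℓ] (τ : ℂ) : ℂ[X] :=
  ∏ i : Option (ZMod ℓ), (X - C (weberConj ℓ i τ))

lemma natDegree_conjPoly [NeZero ℓ] (τ : ℂ) : (conjPoly ℓ τ).natDegree = ℓ + 1 := by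
  rw [conjPoly, natDegree_finsetProd_X_sub_C_eq_card]
  simp

lemma monic_conjPoly [NeZero ℓ] (τ : ℂ) : (conjPoly ℓ τ).Monic :=
  monic_prod_of_monic _ _ fun _ _ ↦ monic_X_sub_C _

lemma isRegularAwayFromInfty_coeff_conjPoly [Fact ℓ.Prime] (hN : ℓ.Coprime 48) (j : ℕ) :
    IsRegularAwayFromInfty fun τ : ℍ ↦ (conjPoly ℓ τ).coeff j := by
  let g (i : Option (ZMod ℓ)) : regularSubring := ⟨_, isRegularAwayFromInfty_weberConj hN i⟩
  let q : regularSubring[X] := ∏ i, (X - C (g i))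
  suffices (fun τ : ℍ ↦ (conjPoly ℓ τ).coeff j) = (q.coeff j : ℍ → ℂ) from this ▸ (q.coeff j).2
  ext τ
  let ev : regularSubring →+* ℂ := (Pi.evalRingHom (fun _ : ℍ ↦ ℂ) τ).comp regularSubring.subtype
  have : q.map ev = conjPoly ℓ τ := by
    simp only [q, conjPoly, Polynomial.map_prod, Polynomial.map_sub, map_X, map_C]
    rfl
  rw [← this, coeff_map]
  rfl

lemma conjPoly_S [Fact ℓ.Prime] (hN : ℓ.Coprime 48) (τ : ℍ) :
    conjPoly ℓ (S • τ : ℍ) = conjPoly ℓ τ := by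
  simp only [conjPoly, weberConj_S hN]
  exact Equiv.prod_comp (conjInv_involutive hN).toPerm fun i ↦ X - C (weberConj ℓ i τ)

lemma conjPoly_T_sq [NeZero ℓ] (hN : ℓ.Coprime 48) (τ : ℍ) :
    conjPoly ℓ (T ^ (2 : ℤ) • τ : ℍ) = (conjPoly ℓ τ).scaleRoots (zeta24 ^ (-ℓ : ℤ)) := by
  obtain ⟨σ, hσ⟩ := exists_weberConj_T_sq (Nat.pos_of_neZero ℓ) hN
  simp only [conjPoly, hσ]
  rw [scaleRoots_prod_X_sub_C]
  exact Equiv.prod_comp σ fun i ↦ X - C (zeta24 ^ (-ℓ : ℤ) * weberConj ℓ i τ)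

lemma zeta24_zpow_pow (n : ℤ) : (zeta24 ^ n) ^ 24 = 1 := by
  rw [← zpow_natCast, zpow_comm, zpow_natCast, zeta24_isPrimitiveRoot.pow_eq_one, one_zpow]

theorem exists_monic_relation [Fact ℓ.Prime] (hN : ℓ.Coprime 48) :
    ∃ P : ℂ[X][X], P.Monic ∧ P.natDegree = ℓ + 1 ∧
      ∀ τ : ℍ, P.evalEval (weberF τ) (weberF (ℓ * τ)) = 0 := by
  have hcoeff (j : ℕ) : ∃ p : ℂ[X], ∀ τ : ℍ, (conjPoly ℓ τ).coeff j = p.eval (weberF τ) := by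
    -- The coefficient of y^j is homogeneous of degree ℓ + 1 - j in the roots, which share one
    -- multiplier.
    refine exists_polynomial_weberF (c := (zeta24 ^ (-ℓ : ℤ)) ^ (ℓ + 1 - j))
      (isRegularAwayFromInfty_coeff_conjPoly hN j) (fun τ ↦ by rw [conjPoly_S hN]) ?_ fun τ ↦ ?_
    · rw [← pow_mul, mul_comm, pow_mul, zeta24_zpow_pow, one_pow]
    · rw [conjPoly_T_sq hN, coeff_scaleRoots, natDegree_conjPoly, mul_comm]
  choose p hp using hcoeff
  have hdeg : (∑ j ∈ Finset.range (ℓ + 1), C (p j) * X ^ j).degree < ((ℓ + 1 : ℕ) : WithBot ℕ) := by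
    rw [← Fin.sum_univ_eq_sum_range fun j ↦ C (p j) * X ^ j]
    exact degree_sum_fin_lt _
  refine ⟨X ^ (ℓ + 1) + ∑ j ∈ Finset.range (ℓ + 1), C (p j) * X ^ j, monic_X_pow_add hdeg, ?_,
    fun τ ↦ ?_⟩
  · exact natDegree_eq_of_degree_eq_some (by
      rw [degree_add_eq_left_of_degree_lt (by rwa [degree_X_pow]), degree_X_pow])
  · have h0 : (conjPoly ℓ τ).eval (weberF (ℓ * τ)) = 0 := by
      rw [conjPoly, eval_prod]
      refine Finset.prod_eq_zero (Finset.mem_univ none) ?_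
      simp [weberConj_none]
    rw [eval_eq_sum_range, natDegree_conjPoly, Finset.sum_range_succ] at h0
    have h1 := (monic_conjPoly (ℓ := ℓ) τ).coeff_natDegree
    rw [natDegree_conjPoly] at h1
    rw [h1] at h0
    simp only [hp] at h0
    rw [← h0]
    simp [evalEval, eval_finsetSum]
    ring

lemma aevalAeval_eq_eval {A B : Type*} [CommSemiring A] [CommSemiring B] [Algebra A B] (x y : B)
    (P : A[X][X]) : aevalAeval x y P = (P.map (aeval x : A[X] →ₐ[A] B).toRingHom).eval y := by
  induction P using Polynomial.induction_on' with
  | add p q hp hq => rw [map_add, hp, hq, Polynomial.map_add, eval_add]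
  | monomial n a => simp [← C_mul_X_pow_eq_monomial]

lemma eventually_ne_of_tendsto {α : Type*} {l : Filter α} {f g : α → ℂ} {a b : ℂ}
    (hf : Tendsto f l (𝓝 a)) (hg : Tendsto g l (𝓝 b)) (hab : a ≠ b) : ∀ᶠ x in l, f x ≠ g x := by
  filter_upwards [(hf.sub hg).eventually_ne (sub_ne_zero.2 hab)] with x hx using sub_ne_zero.1 hx

/-- Because f has a pole at i∞, it eventually avoids the finitely many roots of a nonzero `p`. -/
lemma eq_zero_of_eventually_aeval_weberF {p : ℤ[X]}
    (h : ∀ᶠ τ : ℍ in atImInfty, aeval (weberF τ) p = 0) : p = 0 := by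
  by_contra hp
  have hmap : p.map (algebraMap ℤ ℂ) ≠ 0 :=
    (Polynomial.map_ne_zero_iff (algebraMap ℤ ℂ).injective_int).2 hp
  have hx (x : ℂ) : ∀ᶠ τ : ℍ in atImInfty, weberF τ ≠ x := by
    have h0 : Tendsto (fun τ : ℍ ↦ x * cuspParam τ) atImInfty (𝓝 0) := by
      simpa using tendsto_cuspParam.const_mul x
    filter_upwards [eventually_ne_of_tendsto tendsto_weberF_mul_cuspParam h0 one_ne_zero] with τ hτ hτ'
    exact hτ (by rw [hτ'])
  have hall : ∀ᶠ τ : ℍ in atImInfty, ∀ x ∈ (p.map (algebraMap ℤ ℂ)).roots.toFinset,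
      weberF τ ≠ x := (Finset.eventually_all _).2 fun x _ ↦ hx x
  obtain ⟨τ, h1, h2⟩ := (h.and hall).exists
  refine h2 (weberF τ) ?_ rfl
  rw [Multiset.mem_toFinset, mem_roots hmap, IsRoot, eval_map_algebraMap]
  exact h1

lemma tendsto_weberConj_some [NeZero ℓ] (k : ZMod ℓ) :
    Tendsto (fun τ : ℍ ↦ weberConj ℓ (some k) τ * cuspParam (τ / ℓ)) atImInfty
      (𝓝 ((cexp (2 * Real.pi * Complex.I / ℓ) ^ k.val)⁻¹)) := by
  have hℓ := Nat.pos_of_neZero ℓ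
  have hℓ0 : (ℓ : ℂ) ≠ 0 := by exact_mod_cast hℓ.ne'
  have h := (tendsto_weberF_mul_cuspParam.comp (tendsto_divPoint hℓ (48 * k.val))).mul_const
    ((cexp (2 * Real.pi * Complex.I / ℓ) ^ k.val)⁻¹)
  rw [one_mul] at h
  refine h.congr fun τ ↦ ?_
  have h1 : cuspParam (divPoint hℓ (48 * k.val) τ) =
      cuspParam (τ / ℓ) * cexp (2 * Real.pi * Complex.I / ℓ) ^ k.val := by
    rw [coe_divPoint, add_div, cuspParam_add, ← Complex.exp_nat_mul, cuspParam_def (_ / _ : ℂ),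
      cuspParam_def (_ / _ : ℂ)]
    congr 2
    push_cast
    field_simp
  rw [Function.comp_apply, h1, weberConj_some, ← coe_divPoint hℓ]
  rw [← mul_assoc, mul_inv_cancel_right₀ (pow_ne_zero _ (exp_ne_zero _))]

lemma tendsto_cuspParam_div [NeZero ℓ] :
    Tendsto (fun τ : ℍ ↦ cuspParam (τ / ℓ)) atImInfty (𝓝 0) := by
  refine (tendsto_cuspParam.comp (tendsto_divPoint (Nat.pos_of_neZero ℓ) 0)).congr fun τ ↦ ?_
  rw [Function.comp_apply, coe_divPoint]
  simp

lemma tendsto_weberConj_none [NeZero ℓ] :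
    Tendsto (fun τ : ℍ ↦ weberConj ℓ none τ * cuspParam (τ / ℓ) ^ (ℓ ^ 2)) atImInfty (𝓝 1) := by
  refine (tendsto_weberF_mul_cuspParam.comp (tendsto_mulPoint (Nat.pos_of_neZero ℓ))).congr
    fun τ ↦ ?_
  have hℓ0 : (ℓ : ℂ) ≠ 0 := NeZero.ne _
  rw [Function.comp_apply, coe_mulPoint, weberConj_none, ← cuspParam_natCast_mul]
  congr 2
  push_cast
  field_simp

lemma eventually_weberConj_none_ne [NeZero ℓ] (hℓ : 1 < ℓ) (k : ZMod ℓ) :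
    ∀ᶠ τ : ℍ in atImInfty, weberConj ℓ none τ ≠ weberConj ℓ (some k) τ := by
  have h0 := (tendsto_weberConj_some k).mul (tendsto_cuspParam_div (ℓ := ℓ).pow (ℓ ^ 2 - 1))
  have h2 : 1 < ℓ ^ 2 := Nat.one_lt_pow two_ne_zero hℓ
  rw [zero_pow (by omega), mul_zero] at h0
  filter_upwards [eventually_ne_of_tendsto (tendsto_weberConj_none (ℓ := ℓ)) h0 one_ne_zero] with τ hτ hτ'
  refine hτ ?_
  rw [hτ', mul_assoc, ← pow_succ', Nat.sub_add_cancel h2.le]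

/-- In the parameter `cuspParam (τ / ℓ)`, f(ℓτ) has a pole of order ℓ² and the others simple poles,
whose leading coefficients are distinct ℓth roots of unity. -/
lemma eventually_injective_weberConj [NeZero ℓ] (hℓ : 1 < ℓ) :
    ∀ᶠ τ : ℍ in atImInfty, Function.Injective fun i ↦ weberConj ℓ i τ := by
  have key (i j : Option (ZMod ℓ)) (hij : i ≠ j) :
      ∀ᶠ τ : ℍ in atImInfty, weberConj ℓ i τ ≠ weberConj ℓ j τ := by
    rcases i with _ | i <;> rcases j with _ | j
    · exact (hij rfl).elim
    · exact eventually_weberConj_none_ne hℓ j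
    · filter_upwards [eventually_weberConj_none_ne hℓ i] with τ hτ using hτ.symm
    · have hne : (cexp (2 * Real.pi * Complex.I / ℓ) ^ i.val)⁻¹ ≠
          (cexp (2 * Real.pi * Complex.I / ℓ) ^ j.val)⁻¹ := by
        intro h
        refine hij (congrArg some (ZMod.val_injective ℓ ?_))
        exact (Complex.isPrimitiveRoot_exp ℓ (NeZero.ne ℓ)).pow_inj (ZMod.val_lt i) (ZMod.val_lt j)
          (inv_injective h)
      filter_upwards [eventually_ne_of_tendsto (tendsto_weberConj_some i) (tendsto_weberConj_some j) hne]
        with τ hτ hτ'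
      exact hτ (by rw [hτ'])
  have hall : ∀ᶠ τ : ℍ in atImInfty, ∀ i j : Option (ZMod ℓ), i ≠ j →
      weberConj ℓ i τ ≠ weberConj ℓ j τ := by
    refine eventually_all.2 fun i ↦ eventually_all.2 fun j ↦ ?_
    by_cases hij : i = j
    · exact Eventually.of_forall fun τ h ↦ (h hij).elim
    · filter_upwards [key i j hij] with τ hτ _ using hτ
  filter_upwards [hall] with τ hτ i j hij
  by_contra h
  exact hτ i j h hij

/-- Near i∞ the specialised polynomial in y has ℓ + 1 distinct roots, too many for its degree, so
each coefficient vanishes at f(τ). -/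
theorem eq_zero_of_relation_of_natDegree_le [Fact ℓ.Prime] (hN : ℓ.Coprime 48) {P : ℤ[X][X]}
    (hdeg : P.natDegree ≤ ℓ) (h : ∀ τ : ℍ, aevalAeval (weberF τ) (weberF (ℓ * τ)) P = 0) :
    P = 0 := by
  ext1 j
  refine eq_zero_of_eventually_aeval_weberF ?_
  filter_upwards [eventually_injective_weberConj (Fact.out : ℓ.Prime).one_lt] with τ hτ
  have h0 := eq_zero_of_natDegree_lt_card_of_eval_eq_zero
    (P.map (aeval (weberF τ) : ℤ[X] →ₐ[ℤ] ℂ).toRingHom) hτ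
    (fun i ↦ by rw [← aevalAeval_eq_eval]; exact weberConj_isRoot_relation hN h i τ)
    (by
      refine natDegree_map_le.trans_lt (hdeg.trans_lt ?_)
      simp)
  simpa using congrArg (coeff · j) h0

end Relation

end

/-! ### Existence of the modular polynomial and vanishing of coefficients -/

section

open scoped MatrixGroups Manifold

section ModularPolynomial

lemma Polynomial.exists_pseudo_division {R : Type*} [CommRing R] [IsDomain R] (Q : R[X])
    (hQ : 0 < Q.natDegree) (F : R[X]) :
    ∃ (k : ℕ) (A r : R[X]), C (Q.leadingCoeff ^ k) * F = Q * A + r ∧ r.natDegree < Q.natDegree := by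
  induction hn : F.natDegree using Nat.strong_induction_on generalizing F with
  | _ n ih =>
  by_cases h : F.natDegree < Q.natDegree
  · exact ⟨0, 0, F, by simp, h⟩
  push Not at h
  have hQ0 : Q ≠ 0 := by rintro rfl; simp at hQ
  have hF0 : F ≠ 0 := by rintro rfl; simp at h; omega
  have hlQ : Q.leadingCoeff ≠ 0 := leadingCoeff_ne_zero.2 hQ0
  have hlF : F.leadingCoeff ≠ 0 := leadingCoeff_ne_zero.2 hF0
  set B : R[X] := C F.leadingCoeff * X ^ (F.natDegree - Q.natDegree) with hB
  set G : R[X] := C Q.leadingCoeff * F - Q * B with hG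
  have hG' : G.natDegree < F.natDegree := by
    have hd1 : (C Q.leadingCoeff * F).natDegree = F.natDegree := natDegree_C_mul hlQ
    have hd2 : (Q * B).natDegree = F.natDegree := by
      rw [natDegree_mul hQ0 (mul_ne_zero (C_ne_zero.2 hlF) (pow_ne_zero _ X_ne_zero)),
        natDegree_C_mul_X_pow _ _ hlF]
      omega
    have hle : G.natDegree ≤ F.natDegree := (natDegree_sub_le _ _).trans (by rw [hd1, hd2, max_self])
    refine hle.lt_of_ne fun he ↦ ?_
    have hc : G.coeff F.natDegree = 0 := by
      have e1 : (Q * B).coeff F.natDegree = Q.leadingCoeff * F.leadingCoeff := by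
        rw [← hd2, coeff_natDegree, leadingCoeff_mul, hB, leadingCoeff_C_mul_X_pow]
      rw [hG, coeff_sub, e1, coeff_C_mul, coeff_natDegree, sub_self]
    rw [← he, coeff_natDegree, leadingCoeff_eq_zero] at hc
    rw [hc, natDegree_zero] at he
    omega
  obtain ⟨k, A, r, h1, h2⟩ := ih _ (hn ▸ hG') G rfl
  refine ⟨k + 1, A + C (Q.leadingCoeff ^ k) * B, r, ?_, h2⟩
  have : C Q.leadingCoeff * F = G + Q * B := by rw [hG]; ring
  rw [pow_succ, C_mul, mul_assoc, this, mul_add, h1]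
  ring

variable {ℓ : ℕ}

lemma mdifferentiable_aevalAeval_weberF (hℓ : 0 < ℓ) (P : ℤ[X][X]) :
    MDifferentiable 𝓘(ℂ) 𝓘(ℂ) fun τ : ℍ ↦ aevalAeval (weberF τ) (weberF (ℓ * τ)) P := by
  have hx : MDifferentiable 𝓘(ℂ) 𝓘(ℂ) fun τ : ℍ ↦ weberF τ :=
    isRegularAwayFromInfty_weberF.mdifferentiable
  have hy : MDifferentiable 𝓘(ℂ) 𝓘(ℂ) fun τ : ℍ ↦ weberF (ℓ * τ) :=
    mdifferentiable_weberF_comp (g := fun z ↦ ℓ * z) (by fun_prop)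
      fun z hz ↦ (mulPoint hℓ ⟨z, hz⟩).im_pos
  induction P using Polynomial.induction_on' with
  | add p q hp hq =>
    simp only [map_add]
    exact hp.add hq
  | monomial n a =>
    have ha : MDifferentiable 𝓘(ℂ) 𝓘(ℂ) fun τ : ℍ ↦ aeval (weberF τ) a := by
      induction a using Polynomial.induction_on' with
      | add p q hp hq =>
        simp only [map_add]
        exact hp.add hq
      | monomial m c =>
        simp only [aeval_monomial]
        exact mdifferentiable_const.mul (hx.pow m)
    simp only [← C_mul_X_pow_eq_monomial, map_mul, map_pow, aevalAeval_C, aevalAeval_Y]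
    exact ha.mul (hy.pow n)

/-- Relations form a prime ideal, since holomorphic functions on ℍ have no zero divisors. -/
lemma relation_or_relation (hℓ : 0 < ℓ) {P Q : ℤ[X][X]}
    (h : ∀ τ : ℍ, aevalAeval (weberF τ) (weberF (ℓ * τ)) (P * Q) = 0) :
    (∀ τ : ℍ, aevalAeval (weberF τ) (weberF (ℓ * τ)) P = 0) ∨
      ∀ τ : ℍ, aevalAeval (weberF τ) (weberF (ℓ * τ)) Q = 0 := by
  have := (UpperHalfPlane.mul_eq_zero_iff (mdifferentiable_aevalAeval_weberF hℓ P)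
    (mdifferentiable_aevalAeval_weberF hℓ Q)).1 (by
      ext τ
      have := h τ
      rw [map_mul] at this
      exact this)
  exact this.imp congrFun congrFun

theorem exists_isWeberModularPolynomial (hℓ : 0 < ℓ) {Q : ℤ[X][X]} (hQ : Q ≠ 0)
    (h : ∀ τ : ℍ, aevalAeval (weberF τ) (weberF (ℓ * τ)) Q = 0) :
    ∃ Φ : ℤ[X][X], IsWeberModularPolynomial ℓ Φ := by
  induction Q using WfDvdMonoid.induction_on_irreducible with
  | zero => exact (hQ rfl).elim
  | unit u hu =>
    obtain ⟨v, hv⟩ := hu.exists_right_inv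
    have := congrArg (aevalAeval (weberF UpperHalfPlane.I) (weberF (ℓ * UpperHalfPlane.I))) hv
    rw [map_mul, h, zero_mul, map_one] at this
    exact (zero_ne_one this).elim
  | mul a p ha hp ih =>
    rcases relation_or_relation hℓ h with h | h
    · exact ⟨p, hp, h⟩
    · exact ih ha h

theorem IsWeberModularPolynomial.natDegree_and_leadingCoeff [Fact ℓ.Prime] (hN : ℓ.Coprime 48)
    {Φ Q : ℤ[X][X]} (hΦ : IsWeberModularPolynomial ℓ Φ) {D : ℤ} (hD : D ≠ 0)
    (hdeg : Q.natDegree = ℓ + 1) (hlead : Q.leadingCoeff = C D)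
    (hQ : ∀ τ : ℍ, aevalAeval (weberF τ) (weberF (ℓ * τ)) Q = 0) :
    Φ.natDegree = ℓ + 1 ∧ ∃ d : ℤ, Φ.leadingCoeff = C d := by
  have hQ0 : Q ≠ 0 := by rintro rfl; simp at hdeg
  -- The remainder is a relation of y-degree at most ℓ, so it is zero.
  obtain ⟨k, A, r, hA, hr⟩ := exists_pseudo_division Q (by omega) Φ
  have hr0 : r = 0 := by
    refine eq_zero_of_relation_of_natDegree_le hN (by omega) fun τ ↦ ?_
    have := congrArg (aevalAeval (weberF τ) (weberF (ℓ * τ))) hA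
    rw [map_add, map_mul, map_mul, hΦ.relation, hQ, mul_zero, zero_mul, zero_add] at this
    exact this.symm
  rw [hr0, add_zero] at hA
  have hΦ0 := hΦ.irreducible.ne_zero
  have hk : C (Q.leadingCoeff ^ k) ≠ 0 := by
    rw [hlead]
    exact C_ne_zero.2 (pow_ne_zero _ (C_ne_zero.2 hD))
  have hdvd : Φ ∣ Q := by
    -- Were Φ to divide `A`, cancelling it would leave `Q` dividing a nonzero constant in y.
    refine (hΦ.irreducible.prime.dvd_or_dvd (hA ▸ dvd_mul_left Φ _)).resolve_right ?_
    rintro ⟨B, rfl⟩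
    have h1 : C (Q.leadingCoeff ^ k) = Q * B :=
      mul_left_cancel₀ hΦ0 (by rw [mul_comm, hA]; ring)
    have hB : B ≠ 0 := by rintro rfl; exact hk (by rw [h1, mul_zero])
    have h2 := congrArg natDegree h1
    rw [natDegree_C, natDegree_mul hQ0 hB] at h2
    omega
  obtain ⟨B, hB⟩ := hdvd
  have hB0 : B ≠ 0 := by rintro rfl; exact hQ0 (by rw [hB, mul_zero])
  constructor
  · have h1 : ¬ Φ.natDegree ≤ ℓ := fun h ↦
      hΦ0 (eq_zero_of_relation_of_natDegree_le hN h hΦ.relation)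
    have h2 := congrArg natDegree hB
    rw [natDegree_mul hΦ0 hB0] at h2
    omega
  · have h1 := congrArg leadingCoeff hB
    rw [leadingCoeff_mul, hlead] at h1
    have h2 := congrArg natDegree h1
    rw [natDegree_C, natDegree_mul (leadingCoeff_ne_zero.2 hΦ0) (leadingCoeff_ne_zero.2 hB0)] at h2
    exact ⟨_, eq_C_of_natDegree_eq_zero (by omega)⟩

lemma relation_zpow (P : ℤ[X][X]) (h : ∀ τ : ℍ, aevalAeval (weberF τ) (weberF (ℓ * τ)) P = 0)
    (m : ℤ) (τ : ℍ) :
    aevalAeval (zeta24 ^ (-m) * weberF τ) (zeta24 ^ (-(ℓ * m)) * weberF (ℓ * τ)) P = 0 := by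
  have := h (ModularGroup.T ^ (2 * m) • τ)
  rw [coe_T_zpow_smul] at this
  rw [← weberF_add_two_mul, ← weberF_add_two_mul]
  convert this using 3
  · push_cast; rfl
  · congr 1; push_cast; ring

lemma aevalAeval_eq_sum (P : ℤ[X][X]) {A B : ℕ} (hB : P.natDegree < B)
    (hA : ∀ j, (P.coeff j).natDegree < A) (x y : ℂ) : aevalAeval x y P =
      ∑ p ∈ Finset.range A ×ˢ Finset.range B, ((P.coeff p.2).coeff p.1 : ℂ) * (x ^ p.1 * y ^ p.2) := by
  rw [Finset.sum_product_right, aevalAeval_eq_eval,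
    eval_eq_sum_range' (natDegree_map_le.trans_lt hB)]
  refine Finset.sum_congr rfl fun j _ ↦ ?_
  rw [coeff_map]
  change aeval x (P.coeff j) * _ = _
  rw [aeval_eq_sum_range' (hA j), Finset.sum_mul]
  refine Finset.sum_congr rfl fun i _ ↦ ?_
  rw [zsmul_eq_mul, mul_assoc]

lemma sum_zeta24_zpow (n : ℤ) :
    ∑ m ∈ Finset.range 24, zeta24 ^ (n * m) = if (24 : ℤ) ∣ n then 24 else 0 := by
  have h0 (m : ℕ) : zeta24 ^ (n * m) = (zeta24 ^ n) ^ m := by rw [zpow_mul, zpow_natCast]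
  simp only [h0]
  have h1 := zeta24_isPrimitiveRoot.zpow_eq_one_iff_dvd n
  split_ifs with h
  · rw [h1.2 h]; simp
  · have h2 := mul_geom_sum (zeta24 ^ n) 24
    rw [zeta24_zpow_pow, sub_self] at h2
    exact (mul_eq_zero.1 h2).resolve_left (sub_ne_zero.2 fun h' ↦ h (h1.1 h'))

theorem IsWeberModularPolynomial.coeff_eq_zero [Fact ℓ.Prime] (hN : ℓ.Coprime 48)
    {Φ : ℤ[X][X]} (hΦ : IsWeberModularPolynomial ℓ Φ) (hdeg : Φ.natDegree = ℓ + 1) {d : ℤ}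
    (hlead : Φ.leadingCoeff = C d) {i j : ℕ} (hij : ¬ i + ℓ * j ≡ ℓ + 1 [MOD 24]) :
    (Φ.coeff j).coeff i = 0 := by
  classical
  obtain ⟨A, hA⟩ : ∃ A, ∀ j, (Φ.coeff j).natDegree < A := by
    refine ⟨Φ.support.sup (fun j ↦ (Φ.coeff j).natDegree) + 1, fun j ↦ Nat.lt_succ_of_le ?_⟩
    by_cases hj : j ∈ Φ.support
    · exact Finset.le_sup (f := fun j ↦ (Φ.coeff j).natDegree) hj
    · simp [notMem_support_iff.1 hj]
  let s := Finset.range A ×ˢ Finset.range (ℓ + 2)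
  let c (p : ℕ × ℕ) : ℤ := (Φ.coeff p.2).coeff p.1
  let w (p : ℕ × ℕ) : ℤ := (ℓ + 1) - (p.1 + ℓ * p.2)
  have hw (p : ℕ × ℕ) : (24 : ℤ) ∣ w p ↔ p.1 + ℓ * p.2 ≡ ℓ + 1 [MOD 24] := by
    rw [← Int.natCast_modEq_iff, Int.modEq_iff_dvd]
    simp [w]
  let t := s.filter fun p ↦ ¬ (24 : ℤ) ∣ w p
  let Ψ : ℤ[X][X] := ∑ p ∈ t, C (C (c p) * X ^ p.1) * X ^ p.2
  -- Ψ collects the monomials of Φ in the wrong classes; the goal is Ψ = 0, by showing that it is a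
  -- relation of y-degree at most ℓ.
  have hsum (x y : ℂ) : aevalAeval x y Φ = ∑ p ∈ s, (c p : ℂ) * (x ^ p.1 * y ^ p.2) :=
    aevalAeval_eq_sum Φ (by omega) hA x y
  have hΨdeg : Ψ.natDegree ≤ ℓ := by
    refine natDegree_sum_le_of_forall_le _ _ fun p hp ↦ ?_
    by_cases hc : c p = 0
    · simp [hc]
    refine (natDegree_C_mul_X_pow_le _ _).trans ?_
    by_contra! hlt
    have hp2 : p.2 = ℓ + 1 := by
      have := (Finset.mem_product.1 (Finset.mem_filter.1 hp).1).2
      rw [Finset.mem_range] at this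
      omega
    have hc' : (C d : ℤ[X]).coeff p.1 ≠ 0 := by
      rwa [← hlead, leadingCoeff, hdeg, ← hp2]
    have hp1 : p.1 = 0 := by
      by_contra h
      exact hc' (coeff_C_of_ne_zero h)
    -- Only y^(ℓ+1) can occur in top degree, and its weight is ℓ + 1 - ℓ(ℓ + 1) = 1 - ℓ², a multiple
    -- of 24.
    refine (Finset.mem_filter.1 hp).2 ?_
    obtain ⟨u, hu⟩ := sq_sub_one_of_coprime hN
    refine ⟨-u, ?_⟩
    simp only [w, hp1, hp2]
    push_cast
    linear_combination -hu
  have hΨ (τ : ℍ) : aevalAeval (weberF τ) (weberF (ℓ * τ)) Ψ = 0 := by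
    set x := weberF τ
    set y := weberF (ℓ * τ)
    have e1 : aevalAeval x y Ψ = ∑ p ∈ t, (c p : ℂ) * (x ^ p.1 * y ^ p.2) := by
      simp only [Ψ, map_sum, map_mul, map_pow, aevalAeval_C, aevalAeval_Y, aeval_C, aeval_X]
      refine Finset.sum_congr rfl fun p _ ↦ ?_
      simp [mul_assoc]
    -- Orthogonality of the characters of ℤ/24 writes 24 times this part of Φ as a combination of
    -- the relations translated by τ ↦ τ + 2m.
    have e2 : ∑ p ∈ s with (24 : ℤ) ∣ w p, (c p : ℂ) * (x ^ p.1 * y ^ p.2) = 0 := by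
      have h24 : (24 : ℂ) * ∑ p ∈ s with (24 : ℤ) ∣ w p, (c p : ℂ) * (x ^ p.1 * y ^ p.2) = 0 := by
        calc _ = ∑ p ∈ s, (∑ m ∈ Finset.range 24, zeta24 ^ (w p * m)) *
              ((c p : ℂ) * (x ^ p.1 * y ^ p.2)) := by
              rw [Finset.sum_filter, Finset.mul_sum]
              refine Finset.sum_congr rfl fun p _ ↦ ?_
              rw [sum_zeta24_zpow]
              split_ifs <;> simp
          _ = ∑ m ∈ Finset.range 24, zeta24 ^ ((ℓ + 1) * m : ℤ) *
              aevalAeval (zeta24 ^ (-m : ℤ) * x) (zeta24 ^ (-(ℓ * m) : ℤ) * y) Φ := by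
              simp only [hsum, Finset.sum_mul, Finset.mul_sum]
              rw [Finset.sum_comm]
              refine Finset.sum_congr rfl fun m _ ↦ Finset.sum_congr rfl fun p _ ↦ ?_
              have : zeta24 ^ (w p * m) = zeta24 ^ ((ℓ + 1) * m : ℤ) *
                  ((zeta24 ^ (-m : ℤ)) ^ p.1 * (zeta24 ^ (-(ℓ * m) : ℤ)) ^ p.2) := by
                rw [← zpow_natCast, ← zpow_natCast, ← zpow_mul, ← zpow_mul,
                  ← zpow_add₀ zeta24_ne_zero, ← zpow_add₀ zeta24_ne_zero]
                congr 1
                simp only [w]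
                ring
              rw [this]
              ring
          _ = 0 := Finset.sum_eq_zero fun m _ ↦ by
              rw [relation_zpow Φ hΦ.relation m τ, mul_zero]
      simpa using h24
    have e3 := Finset.sum_filter_add_sum_filter_not s (fun p ↦ (24 : ℤ) ∣ w p)
      fun p ↦ (c p : ℂ) * (x ^ p.1 * y ^ p.2)
    rw [← hsum, hΦ.relation, e2, zero_add] at e3
    rw [e1]
    exact e3
  have hΨ0 := eq_zero_of_relation_of_natDegree_le hN hΨdeg hΨ
  by_contra hne
  have hmem : (i, j) ∈ t := by
    refine Finset.mem_filter.2 ⟨Finset.mem_product.2 ⟨?_, ?_⟩, fun h ↦ hij ((hw _).1 h)⟩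
    · exact Finset.mem_range.2 ((le_natDegree_of_ne_zero hne).trans_lt (hA j))
    · have : Φ.coeff j ≠ 0 := fun h ↦ hne (by rw [h, coeff_zero])
      have := le_natDegree_of_ne_zero this
      exact Finset.mem_range.2 (by omega)
  have hcoeff : (Ψ.coeff j).coeff i = c (i, j) := by
    simp only [Ψ, finsetSum_coeff, coeff_C_mul_X_pow]
    rw [Finset.sum_eq_single_of_mem (i, j) hmem]
    · simp
    · intro p _ hp
      split_ifs with h
      · rw [coeff_C_mul_X_pow, if_neg]
        rintro rfl
        exact hp (by rw [h])
      · simp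
  rw [hΨ0] at hcoeff
  exact hne (by simpa using hcoeff.symm)

end ModularPolynomial

end

theorem mainTheorem5 (ℓ : ℕ) (hℓ : ℓ.Prime) (hN : ℓ.Coprime 48) :
    (∃ Φ : Polynomial (Polynomial ℤ), IsWeberModularPolynomial ℓ Φ) ∧
    ∀ Φ : Polynomial (Polynomial ℤ), IsWeberModularPolynomial ℓ Φ →
      ∀ i j : ℕ, (Φ.coeff j).coeff i ≠ 0 → i + ℓ * j ≡ ℓ + 1 [MOD 24] := by
  have : Fact ℓ.Prime := ⟨hℓ⟩
  obtain ⟨P, hP, hPdeg, hPrel⟩ := exists_monic_relation hN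
  obtain ⟨Q, D, hD, hQdeg, hQlead, hQ⟩ := exists_int_polynomial hℓ.ne_zero hP hPrel
  rw [hPdeg] at hQdeg
  refine ⟨exists_isWeberModularPolynomial hℓ.pos (by rintro rfl; simp at hQdeg) hQ,
    fun Φ hΦ i j hij ↦ ?_⟩
  obtain ⟨hdeg, d, hd⟩ := hΦ.natDegree_and_leadingCoeff hN hD hQdeg hQlead hQ
  by_contra h
  exact hij (hΦ.coeff_eq_zero hN hdeg hd h)
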